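/- **Setting.** Let $W_i=(S_i,Z_i,X_i,Y_i)$, $i\ge 1$, be i.i.d. with law $P$, where $S\in\{\mathrm{obs},\mathrm{exp}\}$ is a regime indicator with $0<P(S=\mathrm{obs})<1$, $X,Y\in\{0,1\}$, and $Z$ takes values in a compact set $\mathcal Z\subset\mathbb R^d$. Let $\eta(z)=(\mu_1(z),\mu_0(z),p_{11}(z),p_{10}(z),p_{01}(z),p_{00}(z))\in\mathbb R^6$ with $\mu_x(z)=P(Y=1\mid X=x,Z=z,S=\mathrm{exp})$ and $p_{xy}(z)=P(X=x,Y=y\mid Z=z,S=\mathrm{obs})$ (any version of these conditional probabilities). Let $\Theta\subset\mathbb R^p$, let $h(\vartheta;z)\in\mathbb R^6$ be a parametric model, $\ell(w,\vartheta)\in\mathbb R$ a loss, $L(\vartheta)=\mathbb E[\ell(W,\vartheta)]$, $L_n(\vartheta)=\frac1n\sum_{i=1}^n\ell(W_i,\vartheta)$. For each $n$ let $\hat\vartheta=\hat\vartheta_n\in\Theta$ be, almost surely, a minimizer of $L_n$ over $\Theta$. Write $H=\nabla^2L$ and $\hat H=\nabla^2L_n$ for the Hessians in $\vartheta$. **Assumptions.**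 (i) *Correct specification:* $\vartheta_0\in\Theta$ and $h(\vartheta_0;z)=\eta(z)$ for all $z\in\mathcal Z$. (ii) *Local M-estimation regularity:* $\vartheta_0$ is an interior point of $\Theta$; $\ell(W,\vartheta)$ is integrable for $\vartheta$ near $\vartheta_0$; $L$ is twice continuously differentiable in a neighbourhood of $\vartheta_0$, has $\vartheta_0$ as a local minimizer, and $H(\vartheta_0)$ is nonsingular; $\hat\vartheta\to\vartheta_0$ in probability; $\mathbb E\|\nabla_\vartheta\ell(W,\vartheta_0)\|^2<\infty$ (so that the normalized sums of scores satisfy a central limit theorem); and there are an open neighbourhood $U$ of $\vartheta_0$ and an integrable function $M(w)$ such that, for $P$-almost every $w$, $\ell(w,\cdot)$ is twice continuously differentiable on $U$ with $\sup_{\vartheta\in U}\|\nabla^2_\vartheta\ell(w,\vartheta)\|\le M(w)$. (iii) *Smooth link:* for each $z\in\mathcal Z$, $\vartheta\mapsto h(\vartheta;z)$ is continuously differentiable at $\vartheta_0$. (iv) *Uniform smoothness:* $(\vartheta,z)\mapsto h(\vartheta;z)$ is continuously differentiable for $\vartheta$ in a neighbourhood of $\vartheta_0$ and $z\in\mathcal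 Z$, and there is $C$ with $\sup_{z\in\mathcal Z}\|\nabla_\vartheta h(\vartheta;z)\|\le C$ for all $\vartheta$ in a neighbourhood of $\vartheta_0$. (v) *Lipschitz in $z$:* there is $C$ with $\|\nabla_\vartheta h(\vartheta_0;z_1)-\nabla_\vartheta h(\vartheta_0;z_2)\|\le C\|z_1-z_2\|$ for all $z_1,z_2\in\mathcal Z$. **Conclusion.** Let $\hat\eta(z)=h(\hat\vartheta;z)$, $$\phi(w;z)=-\nabla_\vartheta h(\vartheta_0;z)\,H(\vartheta_0)^{-1}\,\nabla_\vartheta\ell(w,\vartheta_0),\qquad \hat\phi(w;z)=-\nabla_\vartheta h(\hat\vartheta;z)\,\hat H(\hat\vartheta)^{-1}\,\nabla_\vartheta\ell(w,\hat\vartheta)$$ (with any convention, say $0$, for the inverse of a singular matrix). Then: (U-R1) for every $z\in\mathcal Z$, $\mathbb E[\phi(W;z)]=0$ and $\mathbb E\|\phi(W;z)\|^2<\infty$, and $$\sqrt n\,\sup_{z\in\mathcal Z}\Bigl\|\hat\eta(z)-\eta(z)-\frac1n\sum_{i=1}^n\phi(W_i;z)\Bigr\|\to 0\quad\text{in probability};$$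 (U-R2) $$\sup_{z\in\mathcal Z}\frac1n\sum_{i=1}^n\bigl\|\hat\phi(W_i;z)-\phi(W_i;z)\bigr\|^2\to 0\quad\text{in probability}.$$ -/

import Mathlib

open MeasureTheory ProbabilityTheory Filter Topology
open scoped ENNReal

noncomputable section

namespace PNS

/-- Euclidean space `ℝ^k`. -/
abbrev Vec (k : ℕ) : Type := EuclideanSpace ℝ (Fin k)

/-- One observation `W = (S, Z, X, Y)`: the regime indicator `S` (`true` is the experimental and
`false` the observational regime), the covariates `Z ∈ ℝ^d`, the binary treatment `X` and the
binary outcome `Y`. -/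
abbrev Obs (d : ℕ) : Type := Bool × Vec d × Bool × Bool

namespace Obs

variable {d : ℕ}

/-- The regime indicator. -/
def S (w : Obs d) : Bool := w.1

/-- The covariates. -/
def Z (w : Obs d) : Vec d := w.2.1

/-- The treatment. -/
def X (w : Obs d) : Bool := w.2.2.1

/-- The outcome. -/
def Y (w : Obs d) : Bool := w.2.2.2

end Obs

/-- The law of an observation in the experimental regime. -/
def expLaw {d : ℕ} (P : Measure (Obs d)) : Measure (Obs d) := P[|{w | Obs.S w = true}]

/-- The law of an observation in the observational regime. -/
def obsLaw {d : ℕ} (P : Measure (Obs d)) : Measure (Obs d) := P[|{w | Obs.S w = false}]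

/-- `η = (μ₁, μ₀, p₁₁, p₁₀, p₀₁, p₀₀)` is (a version of) the vector of atomic probabilities:
`μ_x(z) = P^exp(Y = 1 ∣ X = x, Z = z)` and `p_xy(z) = P^obs(X = x, Y = y ∣ Z = z)`. -/
structure IsAtomicProb {d : ℕ} (P : Measure (Obs d)) (η : Vec d → Vec 6) : Prop where
  interventional :
    condExp (MeasurableSpace.comap (fun w : Obs d => (Obs.X w, Obs.Z w)) inferInstance) (expLaw P)
        (fun w => if Obs.Y w = true then (1 : ℝ) else 0)
      =ᵐ[expLaw P] fun w => if Obs.X w = true then η (Obs.Z w) 0 else η (Obs.Z w) 1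
  joint : ∀ x y : Bool,
    condExp (MeasurableSpace.comap (Obs.Z : Obs d → Vec d) inferInstance) (obsLaw P)
        (fun w => if Obs.X w = x ∧ Obs.Y w = y then (1 : ℝ) else 0)
      =ᵐ[obsLaw P] fun w => η (Obs.Z w)
        (match x, y with
          | true, true => 2
          | true, false => 3
          | false, true => 4
          | false, false => 5)

/-- The sampling scheme: `W₀, W₁, …` are i.i.d. with law `P`, a mixture of the two regimes in which
both have positive probability, and the covariates take values in the compact set `𝒵`. -/
structure IsIIDMixtureSample {Ω : Type*} [MeasurableSpace Ω] (ρ : Measure Ω) {d : ℕ}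
    (P : Measure (Obs d)) (W : ℕ → Ω → Obs d) (𝒵 : Set (Vec d)) : Prop where
  measurable : ∀ i, Measurable (W i)
  indep : iIndepFun W ρ
  law : ∀ i, ρ.map (W i) = P
  exp_pos : 0 < P {w | Obs.S w = true}
  obs_pos : 0 < P {w | Obs.S w = false}
  compact : IsCompact 𝒵
  covariates_mem : ∀ᵐ w ∂P, Obs.Z w ∈ 𝒵

/-- The population risk `L(ϑ) = E[ℓ(W, ϑ)]`. -/
def risk {d p : ℕ} (P : Measure (Obs d)) (ℓ : Obs d → Vec p → ℝ) (ϑ : Vec p) : ℝ :=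
  ∫ w, ℓ w ϑ ∂P

/-- The empirical risk `L_n(ϑ) = n⁻¹ ∑_{i < n} ℓ(w_i, ϑ)` of the first `n` terms of a sequence. -/
def empRisk {d p : ℕ} (ℓ : Obs d → Vec p → ℝ) (w : ℕ → Obs d) (n : ℕ) (ϑ : Vec p) : ℝ :=
  (n : ℝ)⁻¹ * ∑ i ∈ Finset.range n, ℓ (w i) ϑ

/-- The Hessian of a real function on `ℝ^p`, as a linear operator: the derivative of the
gradient. -/
def hessian {p : ℕ} (f : Vec p → ℝ) (ϑ : Vec p) : Vec p →L[ℝ] Vec p :=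
  fderiv ℝ (gradient f) ϑ

/-- The derivative `∇_ϑ h(ϑ; z)`, as a linear map `ℝ^p → ℝ^6`. -/
def gradParam {d p : ℕ} (h : Vec p → Vec d → Vec 6) (ϑ : Vec p) (z : Vec d) :
    Vec p →L[ℝ] Vec 6 :=
  fderiv ℝ (fun t => h t z) ϑ

/-- Correct specification, local regularity of the M-estimation problem at `ϑ₀`, and a smooth link
to the atomic probabilities. -/
structure MEstimation {Ω : Type*} [MeasurableSpace Ω] (ρ : Measure Ω) {d p : ℕ}
    (P : Measure (Obs d)) (W : ℕ → Ω → Obs d) (𝒵 : Set (Vec d)) (η : Vec d → Vec 6)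
    (Θ : Set (Vec p)) (ℓ : Obs d → Vec p → ℝ) (h : Vec p → Vec d → Vec 6)
    (ϑ₀ : Vec p) (ϑhat : ℕ → Ω → Vec p) : Prop where
  /-- Correct specification. -/
  specified : ∀ z ∈ 𝒵, h ϑ₀ z = η z
  interior : ϑ₀ ∈ interior Θ
  /-- The risk is finite near `ϑ₀`. -/
  integrable_loss : ∀ᶠ ϑ in 𝓝 ϑ₀, Integrable (fun w => ℓ w ϑ) P
  risk_contDiffAt : ContDiffAt ℝ 2 (risk P ℓ) ϑ₀
  risk_isLocalMin : IsLocalMin (risk P ℓ) ϑ₀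
  hessian_nonsingular : IsUnit (hessian (risk P ℓ) ϑ₀)
  /-- The score is square integrable, so that the normalized score sum of the i.i.d. sample
  satisfies a central limit theorem. -/
  score_memLp : MemLp (fun w => gradient (ℓ w) ϑ₀) 2 P
  /-- Almost surely the loss is twice continuously differentiable near `ϑ₀`, and its Hessian is
  dominated there by an integrable function. -/
  loss_smooth : ∃ U ∈ 𝓝 ϑ₀, IsOpen U ∧ ∃ M : Obs d → ℝ, Integrable M P ∧
    ∀ᵐ w ∂P, ContDiffOn ℝ 2 (ℓ w) U ∧ ∀ ϑ ∈ U, ‖hessian (ℓ w) ϑ‖ ≤ M w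
  /-- `ϑhat n` minimizes the empirical risk of the first `n` observations over `Θ`. -/
  minimizer : ∀ n, ∀ᵐ ω ∂ρ, ϑhat n ω ∈ Θ ∧
    ∀ ϑ ∈ Θ, empRisk ℓ (fun i => W i ω) n (ϑhat n ω) ≤ empRisk ℓ (fun i => W i ω) n ϑ
  consistent : TendstoInMeasure ρ ϑhat atTop (fun _ => ϑ₀)
  /-- Smooth link to the atomic probabilities. -/
  link_smooth : ∀ z ∈ 𝒵, ContDiffAt ℝ 1 (fun ϑ => h ϑ z) ϑ₀

/-- Uniform smoothness of the link: `(ϑ, z) ↦ h(ϑ; z)` is continuously differentiable for `ϑ` near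
`ϑ₀` and `z ∈ 𝒵`, and `∇_ϑ h(ϑ; z)` is bounded there. -/
def UniformSmooth {d p : ℕ} (h : Vec p → Vec d → Vec 6) (𝒵 : Set (Vec d)) (ϑ₀ : Vec p) : Prop :=
  (∃ U ∈ 𝓝 ϑ₀, IsOpen U ∧ ContDiffOn ℝ 1 (fun q : Vec p × Vec d => h q.1 q.2) (U ×ˢ 𝒵)) ∧
    ∃ C : ℝ, ∀ᶠ ϑ in 𝓝 ϑ₀, ∀ z ∈ 𝒵, ‖gradParam h ϑ z‖ ≤ C

/-- `z ↦ ∇_ϑ h(ϑ₀; z)` is Lipschitz on `𝒵`. -/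
def LipschitzGrad {d p : ℕ} (h : Vec p → Vec d → Vec 6) (𝒵 : Set (Vec d)) (ϑ₀ : Vec p) : Prop :=
  ∃ C : ℝ, ∀ z₁ ∈ 𝒵, ∀ z₂ ∈ 𝒵, ‖gradParam h ϑ₀ z₁ - gradParam h ϑ₀ z₂‖ ≤ C * ‖z₁ - z₂‖

/-- The influence function `φ(w; z) = -∇_ϑ h(ϑ₀; z) H(ϑ₀)⁻¹ ∇_ϑ ℓ(w, ϑ₀)`, where `H` is the
Hessian of the population risk. -/
def influence {d p : ℕ} (P : Measure (Obs d)) (ℓ : Obs d → Vec p → ℝ)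
    (h : Vec p → Vec d → Vec 6) (ϑ₀ : Vec p) (w : Obs d) (z : Vec d) : Vec 6 :=
  -gradParam h ϑ₀ z ((hessian (risk P ℓ) ϑ₀).inverse (gradient (ℓ w) ϑ₀))

/-- The plug-in influence function `-∇_ϑ h(t; z) Ĥ_n(t)⁻¹ ∇_ϑ ℓ(w, t)` at a parameter value `t`,
where `Ĥ_n` is the Hessian of the empirical risk of `s 0, …, s (n - 1)` (the inverse of a
singular Hessian is `0`). -/
def pluginInfluence {d p : ℕ} (ℓ : Obs d → Vec p → ℝ) (h : Vec p → Vec d → Vec 6)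
    (s : ℕ → Obs d) (n : ℕ) (t : Vec p) (w : Obs d) (z : Vec d) : Vec 6 :=
  -gradParam h t z ((hessian (empRisk ℓ s n) t).inverse (gradient (ℓ w) t))

/-- Convergence to `0` in (outer) probability of extended nonnegative quantities, which may fail to
be measurable. -/
def TendstoZeroInProb {Ω : Type*} [MeasurableSpace Ω] (ρ : Measure Ω)
    (R : ℕ → Ω → ℝ≥0∞) : Prop :=
  ∀ ε : ℝ≥0∞, 0 < ε → Tendsto (fun n => ρ {ω | ε ≤ R n ω}) atTop (𝓝 0)

/-- Uniform asymptotic linearity of `ηhat` over `𝒵`, with the centred and square-integrable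
influence function `φ`. -/
structure UniformAsymptoticLinearity {Ω : Type*} [MeasurableSpace Ω] (ρ : Measure Ω) {d : ℕ}
    (P : Measure (Obs d)) (W : ℕ → Ω → Obs d) (𝒵 : Set (Vec d)) (η : Vec d → Vec 6)
    (ηhat : ℕ → Ω → Vec d → Vec 6) (φ : Obs d → Vec d → Vec 6) : Prop where
  memLp : ∀ z ∈ 𝒵, MemLp (fun w => φ w z) 2 P
  centred : ∀ z ∈ 𝒵, ∫ w, φ w z ∂P = 0
  expansion : TendstoZeroInProb ρ fun n ω => ENNReal.ofReal (Real.sqrt n) *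
    ⨆ z ∈ 𝒵, ‖ηhat n ω z - η z - (n : ℝ)⁻¹ • ∑ i ∈ Finset.range n, φ (W i ω) z‖ₑ

/-- Uniform consistency over `𝒵`, in the empirical `L²` sense, of the plug-in influence functions
`φhat`. -/
def UniformPluginConsistency {Ω : Type*} [MeasurableSpace Ω] (ρ : Measure Ω) {d : ℕ}
    (W : ℕ → Ω → Obs d) (𝒵 : Set (Vec d))
    (φhat : ℕ → Ω → Obs d → Vec d → Vec 6) (φ : Obs d → Vec d → Vec 6) : Prop :=
  TendstoZeroInProb ρ fun n ω => ⨆ z ∈ 𝒵, ENNReal.ofReal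
    ((n : ℝ)⁻¹ * ∑ i ∈ Finset.range n, ‖φhat n ω (W i ω) z - φ (W i ω) z‖ ^ 2)

end PNS

end

/-! Convergence in probability is encoded as convergence along a filter on `ℕ × Ω`, so that
stochastic orders become the usual `=O` and `=o` along `inProb ρ`. Let `s_n` be the average score at
`ϑ₀`, `H` the population Hessian there, and `Δ_n = ϑhat - ϑ₀`.

The empirical Hessian is uniformly close to `H` on a small ball, by a dominated modulus of
continuity and the law of large numbers (`eventually_hessian_close`). As the empirical gradient
vanishes at `ϑhat`, the mean value inequality gives `H Δ_n + s_n = o(Δ_n)`. Inverting `H` yields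
`Δ_n = O(s_n)` and `Δ_n + H⁻¹ s_n = o(s_n)` (`isLittleO_linearization`). The score is centred and
square integrable, so `√n s_n` has bounded second moments, and by Chebyshev's inequality anything
that is `o(√n s_n)` tends to zero in probability; no limit law is needed.

For the expansion, compactness of `𝒵` makes the linearization of the link uniform in `z`, with
remainder `o(s_n)`. For the plug-in functions, the operators `∇h H⁻¹` converge uniformly in `z`, and
the scores move by at most `M(W_i) ‖Δ_n‖`. Since `M` is only integrable, the average of `M(W_i)²`
may diverge, but it is `o(n)` (`tendsto_sum_sq_div_sq`), while `‖Δ_n‖²` is of order `1/n` in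
probability. -/

namespace PNS

/-! ### Convergence in probability as a filter. -/

section InProbability

variable {Ω : Type*} [MeasurableSpace Ω] {ρ : Measure Ω}

/-- The filter of families of events `(S n)` whose probability tends to one, as `n → ∞`. Convergence
in (outer) probability is convergence along this filter. -/
def inProb (ρ : Measure Ω) : Filter (ℕ × Ω) where
  sets := {S | Tendsto (fun n => ρ {ω | (n, ω) ∉ S}) atTop (𝓝 0)}
  univ_sets := by simp
  sets_of_superset := by
    intro S T hS hST
    exact tendsto_of_tendsto_of_tendsto_of_le_of_le tendsto_const_nhds hS (fun _ => zero_le)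
      (fun n => measure_mono fun ω hω h => hω (hST h))
  inter_sets := by
    intro S T hS hT
    have h := Tendsto.add hS hT
    rw [add_zero] at h
    refine tendsto_of_tendsto_of_tendsto_of_le_of_le tendsto_const_nhds h (fun _ => zero_le)
      (fun n => (measure_mono ?_).trans (measure_union_le _ _))
    intro ω hω
    by_contra hc
    simp only [Set.mem_union, Set.mem_ofPred_eq, not_or, not_not] at hc
    exact hω ⟨hc.1, hc.2⟩

theorem eventually_inProb {Q : ℕ × Ω → Prop} :
    (∀ᶠ q in inProb ρ, Q q) ↔ Tendsto (fun n => ρ {ω | ¬ Q (n, ω)}) atTop (𝓝 0) :=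
  Iff.rfl

theorem eventually_inProb_of_ae {Q : ℕ × Ω → Prop} (h : ∀ n, ∀ᵐ ω ∂ρ, Q (n, ω)) :
    ∀ᶠ q in inProb ρ, Q q := by
  rw [eventually_inProb]
  have : (fun n => ρ {ω | ¬ Q (n, ω)}) = fun _ => 0 := funext fun n => ae_iff.1 (h n)
  rw [this]
  exact tendsto_const_nhds

theorem tendstoZeroInProb_iff {R : ℕ → Ω → ℝ≥0∞} :
    TendstoZeroInProb ρ R ↔ Tendsto (fun q : ℕ × Ω => R q.1 q.2) (inProb ρ) (𝓝 0) := by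
  rw [ENNReal.nhds_zero_basis.tendsto_right_iff]
  refine forall₂_congr fun ε _ => ?_
  simp only [Set.mem_Iio, eventually_inProb, not_lt]

theorem tendsto_inProb_of_tendstoInMeasure {E : Type*} [PseudoMetricSpace E] {f : ℕ → Ω → E} {c : E}
    (h : TendstoInMeasure ρ f atTop fun _ => c) :
    Tendsto (fun q : ℕ × Ω => f q.1 q.2) (inProb ρ) (𝓝 c) := by
  rw [Metric.nhds_basis_eball.tendsto_right_iff]
  intro ε hε
  simpa only [eventually_inProb, Metric.mem_eball, not_lt] using h ε hε

/-- A quantity that is of smaller order than one with bounded second moments tends to zero in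
probability. -/
theorem tendsto_inProb_of_forall_le {X : ℕ × Ω → ℝ≥0∞} {T : ℕ × Ω → ℝ≥0∞} {K : ℝ≥0∞}
    (hK : K ≠ ∞) (hTm : ∀ n, AEMeasurable (fun ω => T (n, ω)) ρ)
    (hT : ∀ n, ∫⁻ ω, T (n, ω) ^ 2 ∂ρ ≤ K)
    (h : ∀ ε : ℝ, 0 < ε → ∀ᶠ q in inProb ρ, X q ≤ ENNReal.ofReal ε * T q) :
    Tendsto X (inProb ρ) (𝓝 0) := by
  rw [ENNReal.nhds_zero_basis.tendsto_right_iff]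
  intro ε hε
  -- The threshold must be finite for Chebyshev's inequality; an infinite one follows from the
  -- threshold `1`.
  wlog hε' : ε ≠ ∞ generalizing ε
  · filter_upwards [this 1 one_pos (by simp)] with q hq
    rw [not_not.1 hε']
    exact lt_trans (Set.mem_Iio.1 hq) ENNReal.one_lt_top
  simp only [Set.mem_Iio, eventually_inProb, not_lt]
  rw [ENNReal.tendsto_nhds_zero]
  intro r hr
  -- If `X ≤ δ T`, then `X ≥ ε` forces `T ≥ ε / δ`, an event of probability at most `K (δ / ε)²`.
  obtain ⟨δ, hδ, hδr⟩ : ∃ δ : ℝ, 0 < δ ∧ K * (ENNReal.ofReal δ / ε) ^ 2 < r / 2 := by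
    have h1 : Tendsto (fun δ : ℝ => K * (ENNReal.ofReal δ / ε) ^ 2) (𝓝[>] 0) (𝓝 0) := by
      have h0 : Tendsto (fun δ : ℝ => ENNReal.ofReal δ) (𝓝[>] 0) (𝓝 0) := by
        have := (ENNReal.continuous_ofReal.tendsto 0).mono_left (nhdsWithin_le_nhds (s := Set.Ioi 0))
        simpa using this
      have h2 := ENNReal.Tendsto.div_const h0 (b := ε) (Or.inr hε.ne')
      have h3 := ENNReal.Tendsto.const_mul (ENNReal.Tendsto.pow (n := 2) h2) (a := K) (Or.inr hK)
      simpa using h3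
    have h2 := (h1.eventually (gt_mem_nhds (ENNReal.half_pos hr.ne'))).and self_mem_nhdsWithin
    obtain ⟨δ, h3, h4⟩ := h2.exists
    exact ⟨δ, h4, h3⟩
  have hev := (eventually_inProb.1 (h δ hδ)).eventually (gt_mem_nhds (ENNReal.half_pos hr.ne'))
  filter_upwards [hev] with n hn
  have hδ0 : ENNReal.ofReal δ ≠ 0 := by simpa using hδ
  have hδt : ENNReal.ofReal δ ≠ ∞ := ENNReal.ofReal_ne_top
  have hsub : {ω | ε ≤ X (n, ω)} ⊆ {ω | ¬ X (n, ω) ≤ ENNReal.ofReal δ * T (n, ω)} ∪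
      {ω | (ε / ENNReal.ofReal δ) ^ 2 ≤ T (n, ω) ^ 2} := by
    intro ω hω
    by_cases hc : X (n, ω) ≤ ENNReal.ofReal δ * T (n, ω)
    · right
      have : ε / ENNReal.ofReal δ ≤ T (n, ω) :=
        ENNReal.div_le_of_le_mul' (le_trans hω hc)
      exact pow_le_pow_left' this 2
    · exact Or.inl hc
  have hc0 : (ε / ENNReal.ofReal δ) ^ 2 ≠ 0 := pow_ne_zero _ (ENNReal.div_pos hε.ne' hδt).ne'
  have hct : (ε / ENNReal.ofReal δ) ^ 2 ≠ ∞ := ENNReal.pow_ne_top (ENNReal.div_ne_top hε' hδ0)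
  have hmk := meas_ge_le_lintegral_div (μ := ρ) ((hTm n).pow_const 2) hc0 hct
  have heq : K / (ε / ENNReal.ofReal δ) ^ 2 = K * (ENNReal.ofReal δ / ε) ^ 2 := by
    rw [div_eq_mul_inv, ENNReal.inv_pow, ENNReal.inv_div (Or.inl hδt) (Or.inl hδ0)]
  calc ρ {ω | ε ≤ X (n, ω)} ≤ _ := measure_mono hsub
    _ ≤ _ := measure_union_le _ _
    _ ≤ r / 2 + r / 2 := by
        refine add_le_add hn.le (hmk.trans ?_)
        refine (ENNReal.div_le_div_right (hT n) _).trans ?_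
        rw [heq]
        exact hδr.le
    _ = r := ENNReal.add_halves r

end InProbability

/-! ### Laws of large numbers and second moments for i.i.d. averages. -/

section Averages

variable {Ω α : Type*} [MeasurableSpace Ω] [MeasurableSpace α] {ρ : Measure Ω} {P : Measure α}
  {W : ℕ → Ω → α}

theorem identDistrib_comp (hm : ∀ i, Measurable (W i)) (hlaw : ∀ i, ρ.map (W i) = P)
    {E : Type*} [MeasurableSpace E] {f : α → E} (hf : AEMeasurable f P) (i j : ℕ) :
    IdentDistrib (fun ω => f (W i ω)) (fun ω => f (W j ω)) ρ ρ :=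
  IdentDistrib.comp_of_aemeasurable (u := f)
    ⟨(hm i).aemeasurable, (hm j).aemeasurable, (hlaw i).trans (hlaw j).symm⟩ (by rwa [hlaw])

theorem pairwise_indepFun_comp (hm : ∀ i, Measurable (W i)) (hlaw : ∀ i, ρ.map (W i) = P)
    (hind : iIndepFun W ρ) {E : Type*} [MeasurableSpace E] {f : α → E} (hf : AEMeasurable f P) :
    Pairwise fun i j => IndepFun (fun ω => f (W i ω)) (fun ω => f (W j ω)) ρ := fun i j hij =>
  IndepFun.comp₀ (hind.indepFun hij) (hm i).aemeasurable (hm j).aemeasurable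
    (by rwa [hlaw]) (by rwa [hlaw])

theorem ae_forall_sample (hm : ∀ i, Measurable (W i)) (hlaw : ∀ i, ρ.map (W i) = P)
    {Q : α → Prop} (h : ∀ᵐ w ∂P, Q w) : ∀ᵐ ω ∂ρ, ∀ i, Q (W i ω) := by
  rw [ae_all_iff]
  intro i
  have h' := h
  rw [← hlaw i] at h'
  exact ae_of_ae_map (hm i).aemeasurable h'

theorem aestronglyMeasurable_comp_sample (hm : ∀ i, Measurable (W i))
    (hlaw : ∀ i, ρ.map (W i) = P) {E : Type*} [TopologicalSpace E] {f : α → E}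
    (hf : AEStronglyMeasurable f P) (i : ℕ) : AEStronglyMeasurable (fun ω => f (W i ω)) ρ :=
  AEStronglyMeasurable.comp_measurable (g := f) (by rwa [hlaw]) (hm i)

theorem ae_tendsto_average (hm : ∀ i, Measurable (W i)) (hlaw : ∀ i, ρ.map (W i) = P)
    (hind : iIndepFun W ρ) {E : Type*} [NormedAddCommGroup E] [NormedSpace ℝ E] [CompleteSpace E]
    [MeasurableSpace E] [BorelSpace E] {f : α → E} (hf : Integrable f P) :
    ∀ᵐ ω ∂ρ, Tendsto (fun n : ℕ => (n : ℝ)⁻¹ • ∑ i ∈ Finset.range n, f (W i ω)) atTop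
      (𝓝 (∫ w, f w ∂P)) := by
  have h := strong_law_ae (μ := ρ) (fun i ω => f (W i ω))
    (Integrable.comp_measurable (g := f) (by rwa [hlaw]) (hm 0))
    (pairwise_indepFun_comp hm hlaw hind hf.aemeasurable)
    (fun i => identDistrib_comp hm hlaw hf.aemeasurable i 0)
  have h2 : ∫ ω, f (W 0 ω) ∂ρ = ∫ w, f w ∂P := by
    rw [← hlaw 0, integral_map (hm 0).aemeasurable (by rw [hlaw]; exact hf.1)]
  rwa [h2] at h

/-- The weak law of large numbers. -/
theorem tendsto_average [IsFiniteMeasure ρ] (hm : ∀ i, Measurable (W i))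
    (hlaw : ∀ i, ρ.map (W i) = P)
    (hind : iIndepFun W ρ) {E : Type*} [NormedAddCommGroup E] [NormedSpace ℝ E] [CompleteSpace E]
    [MeasurableSpace E] [BorelSpace E] {f : α → E} (hf : Integrable f P) :
    Tendsto (fun q : ℕ × Ω => (q.1 : ℝ)⁻¹ • ∑ i ∈ Finset.range q.1, f (W i q.2)) (inProb ρ)
      (𝓝 (∫ w, f w ∂P)) := by
  refine tendsto_inProb_of_tendstoInMeasure
    (f := fun n ω => (n : ℝ)⁻¹ • ∑ i ∈ Finset.range n, f (W i ω))
    (tendstoInMeasure_of_tendsto_ae (fun n => ?_) (ae_tendsto_average hm hlaw hind hf))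
  exact (Finset.aestronglyMeasurable_fun_sum _ fun i _ =>
    aestronglyMeasurable_comp_sample hm hlaw hf.1 i).const_smul _

/-- Convergent averages force `a n / n → 0`. Hence `a i ≤ δ i ≤ δ n` past a fixed index, and the sum
of squares is at most a constant plus `δ n ∑ a i`. This replaces a second moment of `a`. -/
theorem tendsto_sum_sq_div_sq {a : ℕ → ℝ} (ha : ∀ i, 0 ≤ a i) {m : ℝ}
    (h : Tendsto (fun n : ℕ => (n : ℝ)⁻¹ * ∑ i ∈ Finset.range n, a i) atTop (𝓝 m)) :
    Tendsto (fun n : ℕ => ((n : ℝ)⁻¹) ^ 2 * ∑ i ∈ Finset.range n, a i ^ 2) atTop (𝓝 0) := by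
  have hinv : Tendsto (fun n : ℕ => (n : ℝ)⁻¹) atTop (𝓝 0) := tendsto_inv_atTop_nhds_zero_nat
  have hm0 : 0 ≤ m := ge_of_tendsto' h fun n =>
    mul_nonneg (by positivity) (Finset.sum_nonneg fun i _ => ha i)
  -- With `A n` the average, `a n / n = (1 + 1 / n) A (n + 1) - A n`.
  have hdiv : Tendsto (fun n : ℕ => (n : ℝ)⁻¹ * a n) atTop (𝓝 0) := by
    have h1 := (h.comp (tendsto_add_atTop_nat 1)).mul ((hinv.add_const 1))
    have h2 := h1.sub h
    simp only [zero_add, mul_one, sub_self] at h2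
    refine h2.congr' ?_
    filter_upwards [eventually_gt_atTop 0] with n hn
    have : (n : ℝ) ≠ 0 := by positivity
    simp only [Function.comp, Finset.sum_range_succ]
    push_cast
    field_simp
    ring
  rw [Metric.tendsto_atTop']
  intro ε hε
  set δ := ε / (2 * (m + 1)) with hδ
  have hδ0 : 0 < δ := by positivity
  obtain ⟨N, hN⟩ := eventually_atTop.1
    ((hdiv.eventually (gt_mem_nhds hδ0)).and (eventually_gt_atTop 0))
  have hfix : Tendsto (fun n : ℕ => ((n : ℝ)⁻¹) ^ 2 * ∑ i ∈ Finset.range N, a i ^ 2) atTop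
      (𝓝 0) := by
    simpa using (hinv.pow 2).mul_const (∑ i ∈ Finset.range N, a i ^ 2)
  obtain ⟨N', hN'⟩ := eventually_atTop.1
    ((hfix.eventually (gt_mem_nhds (half_pos hε))).and
      ((h.eventually (gt_mem_nhds (lt_add_one m))).and (eventually_ge_atTop (N + 1))))
  refine ⟨N', fun n hn => ?_⟩
  obtain ⟨h1, h2, h3⟩ := hN' n hn.le
  have hn0 : (0 : ℝ) < n := by exact_mod_cast (by omega : 0 < n)
  have hsum : ∑ i ∈ Finset.range n, a i ^ 2 ≤
      ∑ i ∈ Finset.range N, a i ^ 2 + δ * n * ∑ i ∈ Finset.range n, a i := by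
    rw [← Finset.sum_range_add_sum_Ico _ (by omega : N ≤ n)]
    gcongr
    rw [Finset.mul_sum]
    refine (Finset.sum_le_sum (g := fun i => δ * n * a i) fun i hi => ?_).trans
      (Finset.sum_le_sum_of_subset_of_nonneg ?_ fun i _ _ => by have := ha i; positivity)
    · rw [Finset.mem_Ico] at hi
      obtain ⟨h4, h5⟩ := hN i hi.1
      have h6 : (0 : ℝ) < i := by exact_mod_cast h5
      have h7 : a i ≤ δ * i := by
        rw [inv_mul_lt_iff₀ h6] at h4
        linarith
      have h8 : (i : ℝ) ≤ n := by exact_mod_cast hi.2.le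
      have h9 : a i ≤ δ * n := h7.trans (by gcongr)
      rw [sq]
      exact mul_le_mul_of_nonneg_right h9 (ha i)
    · intro i hi
      simp only [Finset.mem_Ico, Finset.mem_range] at *
      exact hi.2
  rw [Real.dist_eq, sub_zero, abs_of_nonneg
    (mul_nonneg (by positivity) (Finset.sum_nonneg fun i _ => by positivity))]
  calc ((n : ℝ)⁻¹) ^ 2 * ∑ i ∈ Finset.range n, a i ^ 2
      ≤ ((n : ℝ)⁻¹) ^ 2 *
        (∑ i ∈ Finset.range N, a i ^ 2 + δ * n * ∑ i ∈ Finset.range n, a i) := by gcongr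
    _ = ((n : ℝ)⁻¹) ^ 2 * ∑ i ∈ Finset.range N, a i ^ 2
        + δ * ((n : ℝ)⁻¹ * ∑ i ∈ Finset.range n, a i) := by field_simp
    _ < ε / 2 + δ * (m + 1) := by gcongr
    _ = ε := by rw [hδ]; field_simp; norm_num

theorem tendsto_sum_sq_div_sq_inProb [IsFiniteMeasure ρ] (hm : ∀ i, Measurable (W i))
    (hlaw : ∀ i, ρ.map (W i) = P) (hind : iIndepFun W ρ) {f : α → ℝ} (hf : Integrable f P) :
    Tendsto (fun q : ℕ × Ω => ((q.1 : ℝ)⁻¹) ^ 2 * ∑ i ∈ Finset.range q.1, f (W i q.2) ^ 2)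
      (inProb ρ) (𝓝 0) := by
  refine tendsto_inProb_of_tendstoInMeasure
    (f := fun n ω => ((n : ℝ)⁻¹) ^ 2 * ∑ i ∈ Finset.range n, f (W i ω) ^ 2)
    (tendstoInMeasure_of_tendsto_ae (fun n => ?_) ?_)
  · exact (Finset.aestronglyMeasurable_fun_sum _ fun i _ =>
      (aestronglyMeasurable_comp_sample hm hlaw hf.1 i).pow 2).const_mul _
  · filter_upwards [ae_tendsto_average hm hlaw hind hf.abs] with ω hω
    have := tendsto_sum_sq_div_sq (a := fun i => |f (W i ω)|) (fun i => abs_nonneg _) hω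
    simpa using this

/-- The normalized sums of a centred square integrable function of an i.i.d. sample have bounded
second moments. -/
theorem lintegral_normalized_sum_sq_le [IsProbabilityMeasure ρ] (hm : ∀ i, Measurable (W i))
    (hlaw : ∀ i, ρ.map (W i) = P) (hind : iIndepFun W ρ) {p : ℕ} {s : α → Vec p}
    (hs : MemLp s 2 P) (hs0 : ∫ w, s w ∂P = 0) :
    ∃ K : ℝ≥0∞, K ≠ ∞ ∧ ∀ n : ℕ,
      ∫⁻ ω, ‖Real.sqrt n • (n : ℝ)⁻¹ • ∑ i ∈ Finset.range n, s (W i ω)‖ₑ ^ 2 ∂ρ ≤ K := by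
  have hPp : IsProbabilityMeasure P := by
    rw [← hlaw 0]; exact Measure.isProbabilityMeasure_map (hm 0).aemeasurable
  have hk : ∀ k, MemLp (fun w => s w k) 2 P := fun k =>
    (EuclideanSpace.proj (𝕜 := ℝ) k).comp_memLp' hs
  have hk0 : ∀ k, ∫ w, s w k ∂P = 0 := by
    intro k
    have := (EuclideanSpace.proj (𝕜 := ℝ) k).integral_comp_comm (hs.integrable one_le_two)
    rw [hs0, map_zero] at this
    exact this
  set V : Fin p → ℝ := fun k => Var[fun w => s w k; P] with hV
  refine ⟨ENNReal.ofReal (∑ k, V k), ENNReal.ofReal_ne_top, fun n => ?_⟩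
  have hL : ∀ k i, MemLp (fun ω => s (W i ω) k) 2 ρ := fun k i =>
    MemLp.comp_of_map (g := fun w => s w k) (by rw [hlaw]; exact hk k) (hm i).aemeasurable
  -- Pairwise independence makes the variances add in each coordinate.
  have hvar : ∀ k, ∫ ω, (∑ i ∈ Finset.range n, s (W i ω) k) ^ 2 ∂ρ = n * V k := by
    intro k
    have h1 := IndepFun.variance_sum (μ := ρ) (X := fun i ω => s (W i ω) k)
      (s := Finset.range n) (fun i _ => hL k i)
      (fun i _ j _ hij => pairwise_indepFun_comp hm hlaw hind (hk k).1.aemeasurable hij)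
    have h2 : ∀ i, Var[fun ω => s (W i ω) k; ρ] = V k := by
      intro i
      have := variance_map (μ := ρ) (X := fun w => s w k) (Y := W i)
        (by rw [hlaw]; exact (hk k).1.aemeasurable) (hm i).aemeasurable
      rw [hlaw] at this
      exact this.symm
    have h3 : ∀ i, ∫ ω, s (W i ω) k ∂ρ = 0 := by
      intro i
      rw [← hk0 k, ← hlaw i, integral_map (f := fun w => s w k) (hm i).aemeasurable
        (by rw [hlaw]; exact (hk k).1)]
    simp only [h2, Finset.sum_const, Finset.card_range, nsmul_eq_mul] at h1
    rw [← h1, variance_of_integral_eq_zero]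
    · simp [Finset.sum_apply]
    · exact Finset.aemeasurable_sum _ fun i _ => (hL k i).1.aemeasurable
    · simp only [Finset.sum_apply]
      rw [integral_finsetSum _ fun i _ => (hL k i).integrable one_le_two]
      simp [h3]
  have hLs : ∀ k, MemLp (fun ω => ∑ i ∈ Finset.range n, s (W i ω) k) 2 ρ := fun k =>
    memLp_finsetSum _ fun i _ => hL k i
  have hpt : ∀ ω, ‖Real.sqrt n • (n : ℝ)⁻¹ • ∑ i ∈ Finset.range n, s (W i ω)‖ₑ ^ 2 =
      ENNReal.ofReal ((n : ℝ)⁻¹ * ∑ k, (∑ i ∈ Finset.range n, s (W i ω) k) ^ 2) := by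
    intro ω
    rw [← ofReal_norm, ← ENNReal.ofReal_pow (norm_nonneg _), norm_smul, norm_smul, mul_pow,
      mul_pow, EuclideanSpace.norm_sq_eq]
    congr 1
    simp only [Real.norm_eq_abs, sq_abs, Real.sq_sqrt (Nat.cast_nonneg n)]
    rw [← mul_assoc]
    congr 1
    · rcases eq_or_ne (n : ℝ) 0 with h | h
      · simp [h]
      · field_simp
    · refine Finset.sum_congr rfl fun k _ => ?_
      simp
  simp_rw [hpt]
  rw [← ofReal_integral_eq_lintegral_ofReal
    ((integrable_finsetSum _ fun k _ => (hLs k).integrable_sq).const_mul _)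
    (ae_of_all _ fun ω => by positivity)]
  apply ENNReal.ofReal_le_ofReal
  rw [integral_const_mul, integral_finsetSum _ fun k _ => (hLs k).integrable_sq]
  simp_rw [hvar]
  rw [← Finset.mul_sum, ← mul_assoc]
  have hV0 : 0 ≤ ∑ k, V k := Finset.sum_nonneg fun k _ => variance_nonneg _ _
  rcases eq_or_ne (n : ℝ) 0 with h | h
  · simpa [h] using hV0
  · rw [inv_mul_cancel₀ h, one_mul]

end Averages

/-! ### Integrals depending on a parameter. -/

section Parametric

variable {α E G : Type*} [MeasurableSpace α] {P : Measure α}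
  [NormedAddCommGroup E] [NormedSpace ℝ E] [FiniteDimensional ℝ E]
  [NormedAddCommGroup G] [NormedSpace ℝ G]

/-- In finite dimension an operator is a continuous function of its values on a basis. -/
theorem aestronglyMeasurable_of_apply {T : α → E →L[ℝ] G}
    (h : ∀ v, AEStronglyMeasurable (fun w => T w v) P) : AEStronglyMeasurable T P := by
  set b := Module.finBasis ℝ E
  have : T = fun w => ∑ i, (ContinuousLinearMap.smulRightL ℝ E G
      (LinearMap.toContinuousLinearMap (b.coord i))) (T w (b i)) := by
    funext w
    ext v
    conv_lhs => rw [← b.sum_repr v, map_sum]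
    simp
  rw [this]
  exact Finset.aestronglyMeasurable_fun_sum _ fun i _ =>
    (ContinuousLinearMap.continuous _).comp_aestronglyMeasurable (h (b i))

/-- The derivative with respect to a parameter is measurable in the other variable. -/
theorem aestronglyMeasurable_fderiv {F : α → E → G} {x : E}
    (hF : ∀ᶠ y in 𝓝 x, AEStronglyMeasurable (fun w => F w y) P)
    (hd : ∀ᵐ w ∂P, DifferentiableAt ℝ (F w) x) :
    AEStronglyMeasurable (fun w => fderiv ℝ (F w) x) P := by
  refine aestronglyMeasurable_of_apply fun v => ?_
  have hlim : Tendsto (fun n : ℕ => x + ((n : ℝ) + 1)⁻¹ • v) atTop (𝓝 x) := by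
    have h0 : Tendsto (fun n : ℕ => ((n : ℝ) + 1)⁻¹) atTop (𝓝 0) := by
      simpa only [one_div] using tendsto_one_div_add_atTop_nhds_zero_nat (𝕜 := ℝ)
    simpa using (h0.smul_const v).const_add x
  -- Directional derivatives are limits of difference quotients; shifting by `N` keeps the points
  -- where `F` is known to be measurable.
  obtain ⟨N, hN⟩ := eventually_atTop.1 (hlim.eventually hF)
  refine aestronglyMeasurable_of_tendsto_ae (u := atTop)
    (f := fun (n : ℕ) w => (((n + N : ℕ) : ℝ) + 1) •
      (F w (x + (((n + N : ℕ) : ℝ) + 1)⁻¹ • v) - F w x))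
    (fun n => ((hN (n + N) (by omega)).sub hF.self_of_nhds).const_smul _) ?_
  filter_upwards [hd] with w hw
  have hc : Tendsto (fun n : ℕ => ‖(n : ℝ) + 1‖) atTop atTop := by
    refine tendsto_norm_atTop_atTop.comp ?_
    exact tendsto_atTop_add_const_right _ _ tendsto_natCast_atTop_atTop
  have h1 : Tendsto (fun n : ℕ => ((n : ℝ) + 1) • (F w (x + ((n : ℝ) + 1)⁻¹ • v) - F w x)) atTop
      (𝓝 (fderiv ℝ (F w) x v)) := hw.hasFDerivAt.lim v hc
  exact h1.comp (tendsto_add_atTop_nat N)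

/-- Differentiation under the integral sign on a ball. -/
theorem hasFDerivAt_integral_ball [CompleteSpace G] {F : α → E → G} {x₀ : E} {r : ℝ} {b : α → ℝ}
    (hm : ∀ x ∈ Metric.ball x₀ r, AEStronglyMeasurable (fun w => F w x) P)
    (hi : Integrable (fun w => F w x₀) P) (hb : Integrable b P)
    (hd : ∀ᵐ w ∂P, ∀ x ∈ Metric.ball x₀ r, DifferentiableAt ℝ (F w) x ∧ ‖fderiv ℝ (F w) x‖ ≤ b w)
    {x : E} (hx : x ∈ Metric.ball x₀ r) :
    HasFDerivAt (fun x => ∫ w, F w x ∂P) (∫ w, fderiv ℝ (F w) x ∂P) x := by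
  have hnhds : Metric.ball x₀ r ∈ 𝓝 x := Metric.isOpen_ball.mem_nhds hx
  have hx₀ : x₀ ∈ Metric.ball x₀ r := Metric.mem_ball_self (Metric.pos_of_mem_ball hx)
  refine hasFDerivAt_integral_of_dominated_of_fderiv_le (F := fun x w => F w x)
    (F' := fun x w => fderiv ℝ (F w) x) (bound := b) hnhds ?_ ?_ ?_ ?_ hb ?_
  · filter_upwards [hnhds] with y hy using hm y hy
  · have h1 : Integrable (fun w => F w x - F w x₀) P := by
      refine (hb.mul_const ‖x - x₀‖).mono' ((hm x hx).sub hi.1) ?_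
      filter_upwards [hd] with w hw
      exact Convex.norm_image_sub_le_of_norm_fderiv_le (fun y hy => (hw y hy).1)
        (fun y hy => (hw y hy).2) (convex_ball _ _) hx₀ hx
    refine (h1.add hi).congr (ae_of_all _ fun w => ?_)
    simp
  · refine aestronglyMeasurable_fderiv ?_ ?_
    · filter_upwards [hnhds] with y hy using hm y hy
    · filter_upwards [hd] with w hw using (hw x hx).1
  · filter_upwards [hd] with w hw y hy using (hw y hy).2
  · filter_upwards [hd] with w hw y hy using (hw y hy).1.hasFDerivAt

/-- The modulus of continuity at a point of a dominated random continuous function has a small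
expectation in a small ball. -/
theorem exists_integrable_modulus {G : Type*} [NormedAddCommGroup G] {F : α → E → G}
    {x₀ : E} {r : ℝ} (hr : 0 < r) {b : α → ℝ}
    (hm : ∀ x ∈ Metric.ball x₀ r, AEStronglyMeasurable (fun w => F w x) P) (hb : Integrable b P)
    (hc : ∀ᵐ w ∂P, ContinuousOn (F w) (Metric.ball x₀ r) ∧
      ∀ x ∈ Metric.ball x₀ r, ‖F w x‖ ≤ b w) {ε : ℝ} (hε : 0 < ε) :
    ∃ δ > 0, δ ≤ r ∧ ∃ m : α → ℝ, Integrable m P ∧ ∫ w, m w ∂P < ε ∧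
      ∀ᵐ w ∂P, ∀ x ∈ Metric.ball x₀ δ, ‖F w x - F w x₀‖ ≤ m w := by
  classical
  have hx₀ : x₀ ∈ Metric.ball x₀ r := Metric.mem_ball_self hr
  set u := TopologicalSpace.denseSeq E
  set δ : ℕ → ℝ := fun k => r * ((k : ℝ) + 1)⁻¹ with hδ
  have hδ0 : ∀ k, 0 < δ k := fun k => by positivity
  have hδr : ∀ k, δ k ≤ r := fun k => by
    refine mul_le_of_le_one_right hr.le (inv_le_one_of_one_le₀ ?_)
    linarith [Nat.cast_nonneg (α := ℝ) k]
  have hδlim : Tendsto δ atTop (𝓝 0) := by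
    have := (tendsto_one_div_add_atTop_nhds_zero_nat (𝕜 := ℝ)).const_mul r
    simpa only [one_div, mul_zero] using this
  -- A supremum over a countable dense set is measurable, and continuity extends its bound to the
  -- whole ball.
  set m : ℕ → α → ℝ≥0∞ := fun k w =>
    ⨆ j, if u j ∈ Metric.ball x₀ (δ k) then ‖F w (u j) - F w x₀‖ₑ else 0 with hmdef
  have hmm : ∀ k, AEMeasurable (m k) P := by
    intro k
    refine AEMeasurable.iSup fun j => ?_
    by_cases hj : u j ∈ Metric.ball x₀ (δ k)
    · simp only [hj, if_true]
      exact ((hm _ (Metric.ball_subset_ball (hδr k) hj)).sub (hm _ hx₀)).enorm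
    · simp only [hj, if_false]
      exact aemeasurable_const
  have hbound : ∀ k, ∀ᵐ w ∂P, m k w ≤ ENNReal.ofReal (2 * b w) := by
    intro k
    filter_upwards [hc] with w hw
    refine iSup_le fun j => ?_
    split_ifs with hj
    · rw [← ofReal_norm]
      refine ENNReal.ofReal_le_ofReal ((norm_sub_le _ _).trans ?_)
      linarith [hw.2 _ hx₀, hw.2 _ (Metric.ball_subset_ball (hδr k) hj)]
    · exact zero_le
  have hfin : ∫⁻ w, ENNReal.ofReal (2 * b w) ∂P ≠ ∞ := (hb.const_mul 2).lintegral_lt_top.ne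
  have hlim : ∀ᵐ w ∂P, Tendsto (fun k => m k w) atTop (𝓝 0) := by
    filter_upwards [hc] with w hw
    rw [ENNReal.tendsto_nhds_zero]
    intro e he
    have h1 : Tendsto (fun x => ‖F w x - F w x₀‖ₑ) (𝓝 x₀) (𝓝 0) := by
      have h2 : Tendsto (F w) (𝓝 x₀) (𝓝 (F w x₀)) :=
        hw.1.continuousAt (Metric.isOpen_ball.mem_nhds hx₀)
      simpa using (h2.sub_const (F w x₀)).enorm
    obtain ⟨t, ht, hte⟩ := Metric.eventually_nhds_iff_ball.1 (h1.eventually (ge_mem_nhds he))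
    filter_upwards [hδlim.eventually (gt_mem_nhds ht)] with k hk
    refine iSup_le fun j => ?_
    split_ifs with hj
    · exact hte _ (Metric.ball_subset_ball hk.le hj)
    · exact zero_le
  -- The moduli are dominated by `2 b` and vanish pointwise as the ball shrinks.
  have hL := tendsto_lintegral_of_dominated_convergence' _ hmm hbound hfin hlim
  rw [lintegral_zero] at hL
  obtain ⟨k, hk⟩ := (hL.eventually (gt_mem_nhds (ENNReal.ofReal_pos.2 hε))).exists
  have hkfin : ∫⁻ w, m k w ∂P ≠ ∞ := (hk.trans ENNReal.ofReal_lt_top).ne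
  refine ⟨δ k, hδ0 k, hδr k, fun w => (m k w).toReal,
    integrable_toReal_of_lintegral_ne_top (hmm k) hkfin, ?_, ?_⟩
  · rw [integral_toReal (hmm k) (ae_lt_top' (hmm k) hkfin)]
    exact (ENNReal.lt_ofReal_iff_toReal_lt hkfin).1 hk
  · filter_upwards [hc, hbound k] with w hw hbw x hx
    have hsub := (TopologicalSpace.denseRange_denseSeq E).open_subset_closure_inter
      (Metric.isOpen_ball (x := x₀) (ε := δ k))
    have hcont : ContinuousWithinAt (fun x => ‖F w x - F w x₀‖)
        (Metric.ball x₀ (δ k) ∩ Set.range u) x := by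
      have : ContinuousOn (fun x => ‖F w x - F w x₀‖) (Metric.ball x₀ r) :=
        (hw.1.sub continuousOn_const).norm
      exact (this x (Metric.ball_subset_ball (hδr k) hx)).mono
        (Set.inter_subset_left.trans (Metric.ball_subset_ball (hδr k)))
    refine hcont.closure_le (hsub hx) continuousWithinAt_const ?_
    rintro _ ⟨hy, j, rfl⟩
    rw [← ENNReal.ofReal_le_iff_le_toReal (ne_top_of_le_ne_top ENNReal.ofReal_ne_top hbw),
      ofReal_norm]
    refine le_iSup_of_le j ?_
    rw [if_pos hy]

end Parametric

/-! ### Uniformity of the link over the covariates. -/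

section Link

variable {d p : ℕ} {h : Vec p → Vec d → Vec 6} {𝒵 : Set (Vec d)} {ϑ₀ : Vec p}

/-- The partial derivative of a jointly continuously differentiable link is continuous at `ϑ₀`,
uniformly over the compact set of covariates. -/
theorem UniformSmooth.exists_ball (hs : UniformSmooth h 𝒵 ϑ₀) (hZ : IsCompact 𝒵) {ε : ℝ}
    (hε : 0 < ε) : ∃ δ > 0, ∀ ϑ ∈ Metric.ball ϑ₀ δ, ∀ z ∈ 𝒵,
      DifferentiableAt ℝ (fun t => h t z) ϑ ∧ ‖gradParam h ϑ z - gradParam h ϑ₀ z‖ ≤ ε := by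
  obtain ⟨⟨U, hU, hUo, hC⟩, -⟩ := hs
  suffices H : ∀ᶠ ϑ in 𝓝 ϑ₀, ∀ z ∈ 𝒵,
      DifferentiableAt ℝ (fun t => h t z) ϑ ∧ ‖gradParam h ϑ z - gradParam h ϑ₀ z‖ ≤ ε from
    Metric.eventually_nhds_iff_ball.1 H
  -- The claim passes to subsets and finite unions, so by compactness it is enough to prove it near
  -- each `z₀`.
  refine hZ.induction_on (p := fun t => ∀ᶠ ϑ in 𝓝 ϑ₀, ∀ z ∈ t,
      DifferentiableAt ℝ (fun t => h t z) ϑ ∧ ‖gradParam h ϑ z - gradParam h ϑ₀ z‖ ≤ ε)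
    (by simp) (fun s t hst ht => ht.mono fun ϑ hϑ z hz => hϑ z (hst hz))
    (fun s t hs ht => (hs.and ht).mono fun ϑ hϑ z hz => hz.elim (hϑ.1 z) (hϑ.2 z)) ?_
  intro z₀ hz₀
  have hmem : (ϑ₀, z₀) ∈ U ×ˢ 𝒵 := ⟨mem_of_mem_nhds hU, hz₀⟩
  have h1 := hC _ hmem
  -- Only a derivative within `U ×ˢ 𝒵` is available, and it need not be unique in the `z`
  -- directions. Its restriction to the parameter directions is the true partial derivative, because
  -- `U` is open.
  rw [show (1 : WithTop ℕ∞) = 0 + 1 by norm_num,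
    contDiffWithinAt_succ_iff_hasFDerivWithinAt' (by simp)] at h1
  obtain ⟨u, hu, -, -, f', hf', hf'c⟩ := h1
  rw [Set.insert_eq_of_mem hmem] at hu
  have hcont : ContinuousWithinAt f' (U ×ˢ 𝒵) (ϑ₀, z₀) := hf'c.continuousWithinAt
  have hη : ∀ᶠ q in 𝓝[U ×ˢ 𝒵] (ϑ₀, z₀), q ∈ u ∧ q.1 ∈ U ∧ ‖f' q - f' (ϑ₀, z₀)‖ < ε / 2 := by
    have h2 : ∀ᶠ q in 𝓝[U ×ˢ 𝒵] (ϑ₀, z₀), ‖f' q - f' (ϑ₀, z₀)‖ < ε / 2 := by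
      have := (Metric.tendsto_nhds.1 hcont) (ε / 2) (half_pos hε)
      simpa only [dist_eq_norm] using this
    filter_upwards [hu, self_mem_nhdsWithin, h2] with q hq hq1 hq2 using ⟨hq, hq1.1, hq2⟩
  rw [nhdsWithin_prod_eq, hUo.nhdsWithin_eq hmem.1] at hη
  obtain ⟨pa, hpa, pb, hpb, hab⟩ := eventually_prod_iff.1 hη
  refine ⟨{z | pb z} ∩ 𝒵, inter_mem hpb self_mem_nhdsWithin, ?_⟩
  filter_upwards [hpa] with ϑ hϑ z hz
  have hder : ∀ t, pa t → HasFDerivAt (fun t => h t z)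
      ((f' (t, z)).comp (ContinuousLinearMap.inl ℝ (Vec p) (Vec d))) t := by
    intro t ht
    obtain ⟨h3, h4, -⟩ := hab ht hz.1
    have h5 : HasFDerivWithinAt (fun t => h t z)
        ((f' (t, z)).comp (ContinuousLinearMap.inl ℝ (Vec p) (Vec d))) U t :=
      HasFDerivWithinAt.comp (g := fun q : Vec p × Vec d => h q.1 q.2) t (hf' _ h3)
        (hasFDerivAt_prodMk_left t z).hasFDerivWithinAt (fun t' ht' => ⟨ht', hz.2⟩)
    exact h5.hasFDerivAt (hUo.mem_nhds h4)
  have hϑ₀ := hpa.self_of_nhds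
  refine ⟨(hder ϑ hϑ).differentiableAt, ?_⟩
  rw [gradParam, gradParam, (hder ϑ hϑ).fderiv, (hder ϑ₀ hϑ₀).fderiv,
    ← ContinuousLinearMap.sub_comp]
  have h6 : ‖f' (ϑ, z) - f' (ϑ₀, z)‖ ≤ ε := by
    have e1 := (hab hϑ hz.1).2.2
    have e2 := (hab hϑ₀ hz.1).2.2
    have e3 := norm_sub_le (f' (ϑ, z) - f' (ϑ₀, z₀)) (f' (ϑ₀, z) - f' (ϑ₀, z₀))
    rw [sub_sub_sub_cancel_right] at e3
    linarith
  refine (ContinuousLinearMap.opNorm_comp_le _ _).trans ?_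
  calc _ ≤ ‖f' (ϑ, z) - f' (ϑ₀, z)‖ * 1 :=
        mul_le_mul_of_nonneg_left (ContinuousLinearMap.norm_inl_le_one ℝ _ _) (norm_nonneg _)
    _ ≤ ε := by rwa [mul_one]

end Link

/-! ### Gradients and Hessians of empirical risks. -/

section Calculus

variable {d p : ℕ}

/-- The Riesz isomorphism from the dual of `ℝ^p`, as a continuous linear map. -/
noncomputable def rieszCLM (p : ℕ) : StrongDual ℝ (Vec p) →L[ℝ] Vec p :=
  LinearMap.toContinuousLinearMap
    { toFun := fun φ => (InnerProductSpace.toDual ℝ (Vec p)).symm φ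
      map_add' := by simp
      map_smul' := by simp }

theorem gradient_eq_rieszCLM (f : Vec p → ℝ) : gradient f = fun x => rieszCLM p (fderiv ℝ f x) :=
  rfl

theorem norm_fderiv_eq_norm_gradient (f : Vec p → ℝ) (x : Vec p) :
    ‖fderiv ℝ f x‖ = ‖gradient f x‖ :=
  ((InnerProductSpace.toDual ℝ (Vec p)).symm.norm_map _).symm

variable {f : Vec p → ℝ} {U : Set (Vec p)}

theorem contDiffOn_gradient (hf : ContDiffOn ℝ 2 f U) (hU : IsOpen U) :
    ContDiffOn ℝ 1 (gradient f) U :=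
  (rieszCLM p).contDiff.comp_contDiffOn (hf.fderiv_of_isOpen hU (by norm_num))

theorem differentiableAt_gradient (hf : ContDiffOn ℝ 2 f U) (hU : IsOpen U) {x : Vec p}
    (hx : x ∈ U) : DifferentiableAt ℝ (gradient f) x :=
  ((contDiffOn_gradient hf hU).differentiableOn (by norm_num)).differentiableAt (hU.mem_nhds hx)

theorem continuousOn_hessian (hf : ContDiffOn ℝ 2 f U) (hU : IsOpen U) :
    ContinuousOn (hessian f) U :=
  (contDiffOn_gradient hf hU).continuousOn_fderiv_of_isOpen hU le_rfl

variable {ℓ : Obs d → Vec p → ℝ} {s : ℕ → Obs d}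

theorem contDiffOn_empRisk (hs : ∀ i, ContDiffOn ℝ 2 (ℓ (s i)) U) (n : ℕ) :
    ContDiffOn ℝ 2 (empRisk ℓ s n) U :=
  contDiffOn_const.mul (ContDiffOn.sum fun i _ => hs i)

theorem gradient_empRisk (hs : ∀ i, ContDiffOn ℝ 2 (ℓ (s i)) U) (hU : IsOpen U) (n : ℕ)
    {x : Vec p} (hx : x ∈ U) :
    gradient (empRisk ℓ s n) x = (n : ℝ)⁻¹ • ∑ i ∈ Finset.range n, gradient (ℓ (s i)) x := by
  have hd : ∀ i, HasFDerivAt (ℓ (s i)) (fderiv ℝ (ℓ (s i)) x) x := fun i =>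
    (((hs i).differentiableOn (by norm_num)).differentiableAt (hU.mem_nhds hx)).hasFDerivAt
  have h1 : HasFDerivAt (empRisk ℓ s n)
      ((n : ℝ)⁻¹ • ∑ i ∈ Finset.range n, fderiv ℝ (ℓ (s i)) x) x :=
    (HasFDerivAt.fun_sum fun i _ => hd i).const_mul _
  simp only [gradient_eq_rieszCLM]
  rw [h1.fderiv, map_smul, map_sum]

theorem hessian_empRisk (hs : ∀ i, ContDiffOn ℝ 2 (ℓ (s i)) U) (hU : IsOpen U) (n : ℕ)
    {x : Vec p} (hx : x ∈ U) :
    hessian (empRisk ℓ s n) x = (n : ℝ)⁻¹ • ∑ i ∈ Finset.range n, hessian (ℓ (s i)) x := by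
  have h0 : gradient (empRisk ℓ s n) =ᶠ[𝓝 x]
      fun y => (n : ℝ)⁻¹ • ∑ i ∈ Finset.range n, gradient (ℓ (s i)) y := by
    filter_upwards [hU.mem_nhds hx] with y hy using gradient_empRisk hs hU n hy
  have h1 : HasFDerivAt (fun y => (n : ℝ)⁻¹ • ∑ i ∈ Finset.range n, gradient (ℓ (s i)) y)
      ((n : ℝ)⁻¹ • ∑ i ∈ Finset.range n, fderiv ℝ (gradient (ℓ (s i))) x) x :=
    (HasFDerivAt.fun_sum fun i _ =>
      (differentiableAt_gradient (hs i) hU hx).hasFDerivAt).fun_const_smul _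
  rw [hessian, h0.fderiv_eq, h1.fderiv]
  rfl

end Calculus

/-! ### Regular losses: differentiation of the risk and the uniform law for Hessians. -/

section Regular

variable {d p : ℕ}

/-- Local regularity of a loss on a ball around `ϑ₀`: integrability, a square integrable score, and
a dominated continuous Hessian. -/
structure RegularLoss (P : Measure (Obs d)) (ℓ : Obs d → Vec p → ℝ) (ϑ₀ : Vec p) (r : ℝ)
    (M : Obs d → ℝ) : Prop where
  pos : 0 < r
  integrable_loss : ∀ ϑ ∈ Metric.ball ϑ₀ r, Integrable (fun w => ℓ w ϑ) P
  integrable_bound : Integrable M P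
  score_memLp : MemLp (fun w => gradient (ℓ w) ϑ₀) 2 P
  smooth : ∀ᵐ w ∂P, ContDiffOn ℝ 2 (ℓ w) (Metric.ball ϑ₀ r) ∧
    ∀ ϑ ∈ Metric.ball ϑ₀ r, ‖hessian (ℓ w) ϑ‖ ≤ M w

variable {P : Measure (Obs d)} {ℓ : Obs d → Vec p → ℝ} {ϑ₀ : Vec p} {r : ℝ} {M : Obs d → ℝ}

theorem norm_gradient_sub_le {w : Obs d} (hw : ContDiffOn ℝ 2 (ℓ w) (Metric.ball ϑ₀ r) ∧
      ∀ ϑ ∈ Metric.ball ϑ₀ r, ‖hessian (ℓ w) ϑ‖ ≤ M w) {ϑ : Vec p} (hϑ : ϑ ∈ Metric.ball ϑ₀ r) :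
    ‖gradient (ℓ w) ϑ - gradient (ℓ w) ϑ₀‖ ≤ M w * ‖ϑ - ϑ₀‖ :=
  Convex.norm_image_sub_le_of_norm_fderiv_le
    (fun _ hy => differentiableAt_gradient hw.1 Metric.isOpen_ball hy) hw.2
    (convex_ball _ _) (Metric.mem_ball_self (Metric.pos_of_mem_ball hϑ)) hϑ

namespace RegularLoss

theorem aestronglyMeasurable_gradient (hR : RegularLoss P ℓ ϑ₀ r M) {ϑ : Vec p}
    (hϑ : ϑ ∈ Metric.ball ϑ₀ r) : AEStronglyMeasurable (fun w => gradient (ℓ w) ϑ) P := by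
  refine (rieszCLM p).continuous.comp_aestronglyMeasurable (aestronglyMeasurable_fderiv ?_ ?_)
  · filter_upwards [Metric.isOpen_ball.mem_nhds hϑ] with y hy using (hR.integrable_loss y hy).1
  · filter_upwards [hR.smooth] with w hw
    exact (hw.1.differentiableOn (by norm_num)).differentiableAt (Metric.isOpen_ball.mem_nhds hϑ)

theorem aestronglyMeasurable_hessian (hR : RegularLoss P ℓ ϑ₀ r M) {ϑ : Vec p}
    (hϑ : ϑ ∈ Metric.ball ϑ₀ r) : AEStronglyMeasurable (fun w => hessian (ℓ w) ϑ) P := by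
  refine aestronglyMeasurable_fderiv ?_ ?_
  · filter_upwards [Metric.isOpen_ball.mem_nhds hϑ] with y hy
      using hR.aestronglyMeasurable_gradient hy
  · filter_upwards [hR.smooth] with w hw
    exact differentiableAt_gradient hw.1 Metric.isOpen_ball hϑ

theorem integrable_hessian (hR : RegularLoss P ℓ ϑ₀ r M) :
    Integrable (fun w => hessian (ℓ w) ϑ₀) P := by
  refine hR.integrable_bound.mono'
    (hR.aestronglyMeasurable_hessian (Metric.mem_ball_self hR.pos)) ?_
  filter_upwards [hR.smooth] with w hw using hw.2 _ (Metric.mem_ball_self hR.pos)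

/-- Domination of the first derivative is not assumed: the Hessian bound and the score at `ϑ₀` give
the integrable majorant `‖gradient (ℓ w) ϑ₀‖ + M w * r` on the ball. -/
theorem gradient_risk [IsFiniteMeasure P] (hR : RegularLoss P ℓ ϑ₀ r M) {ϑ : Vec p}
    (hϑ : ϑ ∈ Metric.ball ϑ₀ r) : gradient (risk P ℓ) ϑ = ∫ w, gradient (ℓ w) ϑ ∂P := by
  have hint : ∀ᵐ w ∂P, ∀ x ∈ Metric.ball ϑ₀ r, DifferentiableAt ℝ (ℓ w) x ∧
      ‖fderiv ℝ (ℓ w) x‖ ≤ ‖gradient (ℓ w) ϑ₀‖ + M w * r := by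
    filter_upwards [hR.smooth] with w hw x hx
    refine ⟨(hw.1.differentiableOn (by norm_num)).differentiableAt
      (Metric.isOpen_ball.mem_nhds hx), ?_⟩
    have hM : 0 ≤ M w := (norm_nonneg _).trans (hw.2 x hx)
    have h1 := norm_gradient_sub_le hw hx
    have h2 : ‖x - ϑ₀‖ ≤ r := by rw [← dist_eq_norm]; exact (Metric.mem_ball.1 hx).le
    have h3 := norm_sub_norm_le (gradient (ℓ w) x) (gradient (ℓ w) ϑ₀)
    rw [norm_fderiv_eq_norm_gradient]
    nlinarith [mul_le_mul_of_nonneg_left h2 hM]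
  have hb : Integrable (fun w => ‖gradient (ℓ w) ϑ₀‖ + M w * r) P :=
    (hR.score_memLp.integrable one_le_two).norm.add (hR.integrable_bound.mul_const r)
  have h := hasFDerivAt_integral_ball (fun x hx => (hR.integrable_loss x hx).1)
    (hR.integrable_loss ϑ₀ (Metric.mem_ball_self hR.pos)) hb hint hϑ
  have hi : Integrable (fun w => fderiv ℝ (ℓ w) ϑ) P := by
    refine hb.mono' (aestronglyMeasurable_fderiv ?_ ?_) ?_
    · filter_upwards [Metric.isOpen_ball.mem_nhds hϑ] with y hy using (hR.integrable_loss y hy).1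
    · filter_upwards [hint] with w hw using (hw ϑ hϑ).1
    · filter_upwards [hint] with w hw using (hw ϑ hϑ).2
  have h2 : fderiv ℝ (risk P ℓ) ϑ = ∫ w, fderiv ℝ (ℓ w) ϑ ∂P := h.fderiv
  simp only [gradient_eq_rieszCLM]
  rw [h2, (rieszCLM p).integral_comp_comm hi]

theorem hessian_risk [IsFiniteMeasure P] (hR : RegularLoss P ℓ ϑ₀ r M) :
    hessian (risk P ℓ) ϑ₀ = ∫ w, hessian (ℓ w) ϑ₀ ∂P := by
  have h₀ := Metric.mem_ball_self (x := ϑ₀) hR.pos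
  have h := hasFDerivAt_integral_ball (F := fun w => gradient (ℓ w))
    (fun x hx => hR.aestronglyMeasurable_gradient hx)
    (hR.score_memLp.integrable one_le_two) hR.integrable_bound
    (hR.smooth.mono fun w hw x hx =>
      ⟨differentiableAt_gradient hw.1 Metric.isOpen_ball hx, hw.2 x hx⟩) h₀
  have h1 : gradient (risk P ℓ) =ᶠ[𝓝 ϑ₀] fun x => ∫ w, gradient (ℓ w) x ∂P := by
    filter_upwards [Metric.isOpen_ball.mem_nhds h₀] with y hy using hR.gradient_risk hy
  rw [hessian, h1.fderiv_eq, h.fderiv]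
  rfl

theorem integral_score_eq_zero [IsFiniteMeasure P] (hR : RegularLoss P ℓ ϑ₀ r M)
    (hmin : IsLocalMin (risk P ℓ) ϑ₀) : ∫ w, gradient (ℓ w) ϑ₀ ∂P = 0 := by
  rw [← hR.gradient_risk (Metric.mem_ball_self hR.pos), gradient_eq_rieszCLM]
  simp only [hmin.fderiv_eq_zero, map_zero]

variable {Ω : Type*} [MeasurableSpace Ω] {ρ : Measure Ω}
  {W : ℕ → Ω → Obs d}

theorem eventually_contDiffOn (hR : RegularLoss P ℓ ϑ₀ r M) (hm : ∀ i, Measurable (W i))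
    (hlaw : ∀ i, ρ.map (W i) = P) : ∀ᶠ q : ℕ × Ω in inProb ρ, ∀ i,
      ContDiffOn ℝ 2 (ℓ (W i q.2)) (Metric.ball ϑ₀ r) ∧
        ∀ ϑ ∈ Metric.ball ϑ₀ r, ‖hessian (ℓ (W i q.2)) ϑ‖ ≤ M (W i q.2) :=
  eventually_inProb_of_ae fun _ => ae_forall_sample hm hlaw hR.smooth

/-- The empirical Hessian is uniformly close to the population Hessian near `ϑ₀`. -/
theorem eventually_hessian_close [IsFiniteMeasure ρ] [IsFiniteMeasure P] (hR : RegularLoss P ℓ ϑ₀ r M)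
    (hm : ∀ i, Measurable (W i)) (hlaw : ∀ i, ρ.map (W i) = P) (hind : iIndepFun W ρ)
    {ε : ℝ} (hε : 0 < ε) : ∃ δ > 0, δ ≤ r ∧ ∀ᶠ q : ℕ × Ω in inProb ρ, ∀ ϑ ∈ Metric.ball ϑ₀ δ,
      ‖hessian (empRisk ℓ (fun i => W i q.2) q.1) ϑ - hessian (risk P ℓ) ϑ₀‖ ≤ ε := by
  -- Half of `ε` pays for the average modulus on the ball, half for the law of large numbers at
  -- `ϑ₀`.
  obtain ⟨δ, hδ, hδr, m, hmi, hmε, hmb⟩ := exists_integrable_modulus (F := fun w => hessian (ℓ w))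
    hR.pos (fun x hx => hR.aestronglyMeasurable_hessian hx) hR.integrable_bound
    (hR.smooth.mono fun w hw => ⟨continuousOn_hessian hw.1 Metric.isOpen_ball, hw.2⟩) (half_pos hε)
  refine ⟨δ, hδ, hδr, ?_⟩
  have h1 := (tendsto_average hm hlaw hind hmi).eventually (gt_mem_nhds hmε)
  have h2 := tendsto_average hm hlaw hind hR.integrable_hessian
  rw [← hR.hessian_risk] at h2
  have h3 := Metric.tendsto_nhds.1 h2 (ε / 2) (half_pos hε)
  have h4 : ∀ᶠ q : ℕ × Ω in inProb ρ, ∀ i, ∀ ϑ ∈ Metric.ball ϑ₀ δ,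
      ‖hessian (ℓ (W i q.2)) ϑ - hessian (ℓ (W i q.2)) ϑ₀‖ ≤ m (W i q.2) :=
    eventually_inProb_of_ae fun _ => ae_forall_sample hm hlaw hmb
  filter_upwards [h1, h3, h4, hR.eventually_contDiffOn hm hlaw] with q q1 q3 q4 q5 ϑ hϑ
  have hb₀ := Metric.mem_ball_self (x := ϑ₀) hR.pos
  rw [hessian_empRisk (fun i => (q5 i).1) Metric.isOpen_ball _ (Metric.ball_subset_ball hδr hϑ)]
  set S := (q.1 : ℝ)⁻¹ • ∑ i ∈ Finset.range q.1, hessian (ℓ (W i q.2)) ϑ₀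
  have e1 : ‖(q.1 : ℝ)⁻¹ • ∑ i ∈ Finset.range q.1, hessian (ℓ (W i q.2)) ϑ - S‖ ≤
      (q.1 : ℝ)⁻¹ • ∑ i ∈ Finset.range q.1, m (W i q.2) := by
    have e0 : (q.1 : ℝ)⁻¹ • ∑ i ∈ Finset.range q.1, hessian (ℓ (W i q.2)) ϑ - S = (q.1 : ℝ)⁻¹ •
        ∑ i ∈ Finset.range q.1, (hessian (ℓ (W i q.2)) ϑ - hessian (ℓ (W i q.2)) ϑ₀) := by
      rw [Finset.sum_sub_distrib]
      exact (smul_sub _ _ _).symm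
    rw [e0, norm_smul, smul_eq_mul, norm_inv, Real.norm_natCast]
    gcongr
    exact norm_sum_le_of_le _ fun i _ => q4 i ϑ hϑ
  rw [dist_eq_norm] at q3
  have e2 := norm_add_le ((q.1 : ℝ)⁻¹ • ∑ i ∈ Finset.range q.1, hessian (ℓ (W i q.2)) ϑ - S)
    (S - hessian (risk P ℓ) ϑ₀)
  rw [sub_add_sub_cancel] at e2
  linarith

end RegularLoss

end Regular

/-! ### Asymptotic linearity of the estimator. -/

section Estimation

open Asymptotics

variable {d p : ℕ} {P : Measure (Obs d)} {ℓ : Obs d → Vec p → ℝ} {ϑ₀ : Vec p} {r : ℝ}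
  {M : Obs d → ℝ} {Ω : Type*} [MeasurableSpace Ω] {ρ : Measure Ω}
  {W : ℕ → Ω → Obs d} {ϑhat : ℕ → Ω → Vec p}

/-- The average score of the first `n` observations. -/
noncomputable def avgScore (ℓ : Obs d → Vec p → ℝ) (ϑ₀ : Vec p) (W : ℕ → Ω → Obs d)
    (q : ℕ × Ω) : Vec p :=
  (q.1 : ℝ)⁻¹ • ∑ i ∈ Finset.range q.1, gradient (ℓ (W i q.2)) ϑ₀

namespace RegularLoss

/-- The empirical gradient minus the linear map `H` has derivative of norm at most `c` near `ϑ₀`.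
The mean value inequality compares its values at `ϑhat`, where the gradient is zero, and at `ϑ₀`,
where it is the average score. -/
theorem isLittleO_score_expansion [IsProbabilityMeasure ρ] [IsFiniteMeasure P]
    (hR : RegularLoss P ℓ ϑ₀ r M) (hm : ∀ i, Measurable (W i))
    (hlaw : ∀ i, ρ.map (W i) = P) (hind : iIndepFun W ρ)
    (hcons : Tendsto (fun q : ℕ × Ω => ϑhat q.1 q.2) (inProb ρ) (𝓝 ϑ₀))
    (hscore : ∀ᶠ q : ℕ × Ω in inProb ρ,
      gradient (empRisk ℓ (fun i => W i q.2) q.1) (ϑhat q.1 q.2) = 0) :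
    (fun q : ℕ × Ω => hessian (risk P ℓ) ϑ₀ (ϑhat q.1 q.2 - ϑ₀) + avgScore ℓ ϑ₀ W q) =o[inProb ρ]
      fun q => ϑhat q.1 q.2 - ϑ₀ := by
  rw [isLittleO_iff]
  intro c hc
  obtain ⟨δ, hδ, hδr, hH⟩ := hR.eventually_hessian_close hm hlaw hind hc
  filter_upwards [hH, hR.eventually_contDiffOn hm hlaw, hscore,
    hcons.eventually (Metric.ball_mem_nhds ϑ₀ hδ)] with q h1 h2 h3 h4
  have hb₀ := Metric.mem_ball_self (x := ϑ₀) hR.pos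
  have hsm := contDiffOn_empRisk (s := fun i => W i q.2) (fun i => (h2 i).1) q.1
  have h5 := Convex.norm_image_sub_le_of_norm_fderiv_le' (𝕜 := ℝ)
    (fun y hy => differentiableAt_gradient hsm Metric.isOpen_ball (Metric.ball_subset_ball hδr hy))
    h1 (convex_ball _ _) (Metric.mem_ball_self hδ) h4
  rw [h3, gradient_empRisk (fun i => (h2 i).1) Metric.isOpen_ball _ hb₀] at h5
  rw [← norm_neg]
  refine le_of_eq_of_le (congrArg norm ?_) h5
  simp only [avgScore]
  abel

/-- The estimator is asymptotically linear, with remainder of smaller order than the average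
score. -/
theorem isLittleO_linearization [IsProbabilityMeasure ρ] [IsFiniteMeasure P]
    (hR : RegularLoss P ℓ ϑ₀ r M) (hm : ∀ i, Measurable (W i))
    (hlaw : ∀ i, ρ.map (W i) = P) (hind : iIndepFun W ρ)
    (hH : IsUnit (hessian (risk P ℓ) ϑ₀))
    (hcons : Tendsto (fun q : ℕ × Ω => ϑhat q.1 q.2) (inProb ρ) (𝓝 ϑ₀))
    (hscore : ∀ᶠ q : ℕ × Ω in inProb ρ,
      gradient (empRisk ℓ (fun i => W i q.2) q.1) (ϑhat q.1 q.2) = 0) :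
    (fun q : ℕ × Ω => ϑhat q.1 q.2 - ϑ₀) =O[inProb ρ] avgScore ℓ ϑ₀ W ∧
    (fun q : ℕ × Ω => ϑhat q.1 q.2 - ϑ₀ +
      (hessian (risk P ℓ) ϑ₀).inverse (avgScore ℓ ϑ₀ W q)) =o[inProb ρ] avgScore ℓ ϑ₀ W := by
  set A := hessian (risk P ℓ) ϑ₀
  have hBA : ∀ v, A.inverse (A v) = v := by
    intro v
    rw [← ContinuousLinearMap.ringInverse_eq_inverse, ← mul_apply_eq_comp,
      Ring.inverse_mul_cancel A hH, one_apply_eq_self]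
  have h1 := (A.inverse.isBigO_comp _ _).trans_isLittleO
    (hR.isLittleO_score_expansion hm hlaw hind hcons hscore)
  simp only [map_add, A, hBA] at h1
  have h2 : (fun q : ℕ × Ω => ϑhat q.1 q.2 - ϑ₀) =O[inProb ρ] avgScore ℓ ϑ₀ W := by
    -- By `h1`, `Δ_n` equals `-H⁻¹ s_n` up to `o(Δ_n)`; absorbing that error gives the rate.
    refine h1.right_isBigO_sub.trans ?_
    have h3 := (A.inverse.isBigO_comp (avgScore ℓ ϑ₀ W) (inProb ρ)).neg_left
    refine h3.congr_left fun q => ?_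
    simp [A]
  exact ⟨h2, h1.trans_isBigO h2⟩

/-- Inversion is continuous at a unit, so the default value at singular operators does not affect
the limit. -/
theorem tendsto_inverse_hessian [IsProbabilityMeasure ρ] [IsFiniteMeasure P]
    (hR : RegularLoss P ℓ ϑ₀ r M) (hm : ∀ i, Measurable (W i))
    (hlaw : ∀ i, ρ.map (W i) = P) (hind : iIndepFun W ρ)
    (hH : IsUnit (hessian (risk P ℓ) ϑ₀))
    (hcons : Tendsto (fun q : ℕ × Ω => ϑhat q.1 q.2) (inProb ρ) (𝓝 ϑ₀)) :
    Tendsto (fun q : ℕ × Ω => (hessian (empRisk ℓ (fun i => W i q.2) q.1) (ϑhat q.1 q.2)).inverse)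
      (inProb ρ) (𝓝 (hessian (risk P ℓ) ϑ₀).inverse) := by
  have h1 : Tendsto (fun q : ℕ × Ω => hessian (empRisk ℓ (fun i => W i q.2) q.1) (ϑhat q.1 q.2))
      (inProb ρ) (𝓝 (hessian (risk P ℓ) ϑ₀)) := by
    rw [Metric.nhds_basis_closedBall.tendsto_right_iff]
    intro ε hε
    obtain ⟨δ, hδ, -, h2⟩ := hR.eventually_hessian_close hm hlaw hind hε
    filter_upwards [h2, hcons.eventually (Metric.ball_mem_nhds ϑ₀ hδ)] with q h3 h4
    rw [mem_closedBall_iff_norm]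
    exact h3 _ h4
  obtain ⟨u, hu⟩ := hH
  rw [← hu] at h1 ⊢
  simp only [← ContinuousLinearMap.ringInverse_eq_inverse]
  exact (NormedRing.inverse_continuousAt u).tendsto.comp h1

/-- A quantity of smaller order than the normalized average score tends to zero in probability. -/
theorem tendsto_inProb_of_forall_le_score [IsProbabilityMeasure ρ] [IsFiniteMeasure P]
    (hR : RegularLoss P ℓ ϑ₀ r M) (hm : ∀ i, Measurable (W i)) (hlaw : ∀ i, ρ.map (W i) = P)
    (hind : iIndepFun W ρ) (hmin : IsLocalMin (risk P ℓ) ϑ₀) {X : ℕ × Ω → ℝ≥0∞}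
    (hX : ∀ ε : ℝ, 0 < ε → ∀ᶠ q in inProb ρ,
      X q ≤ ENNReal.ofReal ε * ‖Real.sqrt q.1 • avgScore ℓ ϑ₀ W q‖ₑ) :
    Tendsto X (inProb ρ) (𝓝 0) := by
  obtain ⟨K, hK, hKf⟩ := lintegral_normalized_sum_sq_le hm hlaw hind hR.score_memLp
    (hR.integral_score_eq_zero hmin)
  have hmeas : ∀ n : ℕ, AEStronglyMeasurable (fun ω => avgScore ℓ ϑ₀ W (n, ω)) ρ := by
    intro n
    have h1 : ∀ i, AEStronglyMeasurable (fun ω => gradient (ℓ (W i ω)) ϑ₀) ρ := fun i =>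
      aestronglyMeasurable_comp_sample (f := fun w => gradient (ℓ w) ϑ₀) hm hlaw hR.score_memLp.1 i
    have h2 : AEStronglyMeasurable
        (fun ω => ∑ i ∈ Finset.range n, gradient (ℓ (W i ω)) ϑ₀) ρ :=
      Finset.aestronglyMeasurable_fun_sum _ fun i _ => h1 i
    exact h2.const_smul (n : ℝ)⁻¹
  exact tendsto_inProb_of_forall_le (T := fun q => ‖Real.sqrt q.1 • avgScore ℓ ϑ₀ W q‖ₑ) hK
    (fun n => ((hmeas n).const_smul (Real.sqrt n)).enorm) hKf hX

/-- Although the Lipschitz constants of the scores are only integrable, their empirical second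
moment grows more slowly than the squared estimation error decreases. -/
theorem eventually_average_sq_mul_le [IsProbabilityMeasure ρ] [IsFiniteMeasure P]
    (hR : RegularLoss P ℓ ϑ₀ r M) (hm : ∀ i, Measurable (W i))
    (hlaw : ∀ i, ρ.map (W i) = P) (hind : iIndepFun W ρ) (hmin : IsLocalMin (risk P ℓ) ϑ₀)
    (hO : (fun q : ℕ × Ω => ϑhat q.1 q.2 - ϑ₀) =O[inProb ρ] avgScore ℓ ϑ₀ W)
    {c : ℝ} (hc : 0 < c) : ∀ᶠ q : ℕ × Ω in inProb ρ,
      ((q.1 : ℝ)⁻¹ * ∑ i ∈ Finset.range q.1, M (W i q.2) ^ 2) * ‖ϑhat q.1 q.2 - ϑ₀‖ ^ 2 ≤ c := by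
  obtain ⟨L, hL, hLb⟩ := hO.exists_pos
  have hsum0 : ∀ q : ℕ × Ω, 0 ≤ ∑ i ∈ Finset.range q.1, M (W i q.2) ^ 2 := fun q =>
    Finset.sum_nonneg fun i _ => sq_nonneg _
  have key : Tendsto (fun q : ℕ × Ω => ENNReal.ofReal
      (Real.sqrt ((q.1 : ℝ)⁻¹ * ∑ i ∈ Finset.range q.1, M (W i q.2) ^ 2) * ‖ϑhat q.1 q.2 - ϑ₀‖))
      (inProb ρ) (𝓝 0) := by
    refine hR.tendsto_inProb_of_forall_le_score hm hlaw hind hmin fun ε hε => ?_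
    have h1 := (tendsto_sum_sq_div_sq_inProb hm hlaw hind hR.integrable_bound).sqrt
    rw [Real.sqrt_zero] at h1
    filter_upwards [h1.eventually (gt_mem_nhds (div_pos hε hL)), hLb.bound] with q h2 h3
    rw [← ofReal_norm, ← ENNReal.ofReal_mul hε.le, norm_smul,
      Real.norm_of_nonneg (Real.sqrt_nonneg _)]
    apply ENNReal.ofReal_le_ofReal
    -- Moving a factor `√n` onto the estimation error leaves `n⁻² ∑ M²`, which tends to zero.
    have h4 : Real.sqrt ((q.1 : ℝ)⁻¹ * ∑ i ∈ Finset.range q.1, M (W i q.2) ^ 2) =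
        Real.sqrt ((q.1 : ℝ)⁻¹ ^ 2 * ∑ i ∈ Finset.range q.1, M (W i q.2) ^ 2) *
          Real.sqrt q.1 := by
      rw [← Real.sqrt_mul (mul_nonneg (by positivity) (hsum0 q))]
      congr 1
      rcases eq_or_ne (q.1 : ℝ) 0 with h | h
      · simp [h]
      · field_simp
    rw [h4]
    calc _ ≤ ε / L * Real.sqrt q.1 * (L * ‖avgScore ℓ ϑ₀ W q‖) := by gcongr
      _ = ε * (Real.sqrt q.1 * ‖avgScore ℓ ϑ₀ W q‖) := by field_simp
  have hsc : 0 < ENNReal.ofReal (Real.sqrt c) := ENNReal.ofReal_pos.2 (Real.sqrt_pos.2 hc)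
  filter_upwards [key.eventually (ge_mem_nhds hsc)] with q hq
  rw [ENNReal.ofReal_le_ofReal_iff (Real.sqrt_nonneg _)] at hq
  have := pow_le_pow_left₀ (by positivity) hq 2
  rwa [mul_pow, Real.sq_sqrt (mul_nonneg (by positivity) (hsum0 q)), Real.sq_sqrt hc.le] at this

end RegularLoss

theorem MEstimation.exists_regularLoss {𝒵 : Set (Vec d)} {η : Vec d → Vec 6} {Θ : Set (Vec p)}
    {h : Vec p → Vec d → Vec 6} (hM : MEstimation ρ P W 𝒵 η Θ ℓ h ϑ₀ ϑhat) :
    ∃ r M, RegularLoss P ℓ ϑ₀ r M := by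
  obtain ⟨U, hU, -, M, hMi, hsm⟩ := hM.loss_smooth
  obtain ⟨r, hr, hball⟩ := Metric.mem_nhds_iff.1 (inter_mem hU hM.integrable_loss)
  exact ⟨r, M, hr, fun ϑ hϑ => (hball hϑ).2, hMi, hM.score_memLp, hsm.mono fun w hw =>
    ⟨hw.1.mono fun ϑ hϑ => (hball hϑ).1, fun ϑ hϑ => hw.2 ϑ (hball hϑ).1⟩⟩

/-- By consistency `ϑhat` lies in the interior of `Θ` with probability tending to one, and there a
minimizer over `Θ` is a local minimizer. -/
theorem MEstimation.eventually_score_eq_zero {𝒵 : Set (Vec d)} {η : Vec d → Vec 6}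
    {Θ : Set (Vec p)} {h : Vec p → Vec d → Vec 6} (hM : MEstimation ρ P W 𝒵 η Θ ℓ h ϑ₀ ϑhat) :
    ∀ᶠ q : ℕ × Ω in inProb ρ,
      gradient (empRisk ℓ (fun i => W i q.2) q.1) (ϑhat q.1 q.2) = 0 := by
  have hcons := tendsto_inProb_of_tendstoInMeasure hM.consistent
  filter_upwards [hcons.eventually (isOpen_interior.mem_nhds hM.interior),
    eventually_inProb_of_ae (Q := fun q : ℕ × Ω => ϑhat q.1 q.2 ∈ Θ ∧ ∀ ϑ ∈ Θ,
      empRisk ℓ (fun i => W i q.2) q.1 (ϑhat q.1 q.2) ≤ empRisk ℓ (fun i => W i q.2) q.1 ϑ)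
      hM.minimizer] with q h1 h2
  have h3 : IsLocalMin (empRisk ℓ (fun i => W i q.2) q.1) (ϑhat q.1 q.2) := by
    filter_upwards [mem_interior_iff_mem_nhds.1 h1] with ϑ hϑ using h2.2 ϑ hϑ
  simp only [gradient_eq_rieszCLM, h3.fderiv_eq_zero, map_zero]

end Estimation

/-! ### Uniform expansion of the link and consistency of the plug-in influence functions. -/

section PlugIn

open Asymptotics

variable {d p : ℕ} {P : Measure (Obs d)} {ℓ : Obs d → Vec p → ℝ} {ϑ₀ : Vec p} {r : ℝ}
  {M : Obs d → ℝ} {Ω : Type*} [MeasurableSpace Ω] {ρ : Measure Ω}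
  {W : ℕ → Ω → Obs d} {ϑhat : ℕ → Ω → Vec p} {𝒵 : Set (Vec d)}
  {h : Vec p → Vec d → Vec 6}

theorem UniformSmooth.exists_bound (hs : UniformSmooth h 𝒵 ϑ₀) :
    ∃ C, 0 < C ∧ ∀ z ∈ 𝒵, ‖gradParam h ϑ₀ z‖ ≤ C := by
  obtain ⟨-, C, hC⟩ := hs
  exact ⟨max C 1, by positivity, fun z hz => (hC.self_of_nhds z hz).trans (le_max_left _ _)⟩

theorem average_influence {Ω : Type*} {W : ℕ → Ω → Obs d} (q : ℕ × Ω) (z : Vec d) :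
    (q.1 : ℝ)⁻¹ • ∑ i ∈ Finset.range q.1, influence P ℓ h ϑ₀ (W i q.2) z =
      -gradParam h ϑ₀ z ((hessian (risk P ℓ) ϑ₀).inverse (avgScore ℓ ϑ₀ W q)) := by
  simp only [influence, avgScore, map_smul, map_sum, Finset.sum_neg_distrib, smul_neg]

/-- The remainder in the linearization of a smooth link is of smaller order than the average score,
uniformly over the covariates. -/
theorem eventually_remainder_le (hs : UniformSmooth h 𝒵 ϑ₀) (hZ : IsCompact 𝒵)
    (hcons : Tendsto (fun q : ℕ × Ω => ϑhat q.1 q.2) (inProb ρ) (𝓝 ϑ₀))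
    (hO : (fun q : ℕ × Ω => ϑhat q.1 q.2 - ϑ₀) =O[inProb ρ] avgScore ℓ ϑ₀ W)
    (ho : (fun q : ℕ × Ω => ϑhat q.1 q.2 - ϑ₀ +
      (hessian (risk P ℓ) ϑ₀).inverse (avgScore ℓ ϑ₀ W q)) =o[inProb ρ] avgScore ℓ ϑ₀ W)
    {ε : ℝ} (hε : 0 < ε) : ∀ᶠ q : ℕ × Ω in inProb ρ, ∀ z ∈ 𝒵,
      ‖h (ϑhat q.1 q.2) z - h ϑ₀ z -
        (q.1 : ℝ)⁻¹ • ∑ i ∈ Finset.range q.1, influence P ℓ h ϑ₀ (W i q.2) z‖ ≤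
        ε * ‖avgScore ℓ ϑ₀ W q‖ := by
  obtain ⟨L, hL, hLb⟩ := hO.exists_pos
  obtain ⟨C, hC, hCb⟩ := hs.exists_bound
  -- One half of `ε` covers the nonlinearity of the link, with `‖Δ_n‖ ≤ L ‖s_n‖`; the other covers
  -- the remainder of the estimator, magnified by at most `C`.
  obtain ⟨δ, hδ, hδb⟩ := hs.exists_ball hZ (ε := ε / (2 * L)) (by positivity)
  filter_upwards [hcons.eventually (Metric.ball_mem_nhds ϑ₀ hδ), hLb.bound,
    ho.bound (show 0 < ε / (2 * C) by positivity)] with q h1 h2 h3 z hz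
  have h4 := Convex.norm_image_sub_le_of_norm_fderiv_le' (𝕜 := ℝ) (f := fun t => h t z)
    (φ := gradParam h ϑ₀ z) (fun y hy => (hδb y hy z hz).1) (fun y hy => (hδb y hy z hz).2)
    (convex_ball _ _) (Metric.mem_ball_self hδ) h1
  have h5 := (gradParam h ϑ₀ z).le_of_opNorm_le_of_le (hCb z hz) h3
  rw [average_influence]
  calc _ = ‖(h (ϑhat q.1 q.2) z - h ϑ₀ z - gradParam h ϑ₀ z (ϑhat q.1 q.2 - ϑ₀)) +
        gradParam h ϑ₀ z (ϑhat q.1 q.2 - ϑ₀ +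
          (hessian (risk P ℓ) ϑ₀).inverse (avgScore ℓ ϑ₀ W q))‖ := by
        rw [map_add]
        congr 1
        abel
    _ ≤ ε / (2 * L) * (L * ‖avgScore ℓ ϑ₀ W q‖) +
        C * (ε / (2 * C) * ‖avgScore ℓ ϑ₀ W q‖) :=
      (norm_add_le _ _).trans (add_le_add (h4.trans (by gcongr)) h5)
    _ = ε * ‖avgScore ℓ ϑ₀ W q‖ := by field_simp; ring

theorem eventually_comp_inverse_close (hs : UniformSmooth h 𝒵 ϑ₀) (hZ : IsCompact 𝒵)
    (hcons : Tendsto (fun q : ℕ × Ω => ϑhat q.1 q.2) (inProb ρ) (𝓝 ϑ₀))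
    {J : ℕ × Ω → Vec p →L[ℝ] Vec p} {J₀ : Vec p →L[ℝ] Vec p}
    (hJ : Tendsto J (inProb ρ) (𝓝 J₀)) {ε : ℝ} (hε : 0 < ε) :
    ∀ᶠ q : ℕ × Ω in inProb ρ, ∀ z ∈ 𝒵,
      ‖(gradParam h (ϑhat q.1 q.2) z).comp (J q) - (gradParam h ϑ₀ z).comp J₀‖ ≤ ε := by
  obtain ⟨C, hC, hCb⟩ := hs.exists_bound
  set K := ‖J₀‖ + 1 with hK
  have hK0 : 0 < K := by positivity
  obtain ⟨δ, hδ, hδb⟩ := hs.exists_ball hZ (ε := ε / (2 * K)) (by positivity)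
  have hJn := hJ.norm.eventually (gt_mem_nhds (lt_add_one ‖J₀‖))
  have hJc := Metric.tendsto_nhds.1 hJ (ε / (2 * C)) (by positivity)
  filter_upwards [hcons.eventually (Metric.ball_mem_nhds ϑ₀ hδ), hJn, hJc] with q h1 h2 h3 z hz
  rw [dist_eq_norm] at h3
  have e : (gradParam h (ϑhat q.1 q.2) z).comp (J q) - (gradParam h ϑ₀ z).comp J₀ =
      (gradParam h (ϑhat q.1 q.2) z - gradParam h ϑ₀ z).comp (J q) +
        (gradParam h ϑ₀ z).comp (J q - J₀) := by
    rw [ContinuousLinearMap.sub_comp, ContinuousLinearMap.comp_sub]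
    abel
  rw [e]
  calc _ ≤ ‖gradParam h (ϑhat q.1 q.2) z - gradParam h ϑ₀ z‖ * ‖J q‖ +
        ‖gradParam h ϑ₀ z‖ * ‖J q - J₀‖ :=
        (norm_add_le _ _).trans (add_le_add (ContinuousLinearMap.opNorm_comp_le _ _)
          (ContinuousLinearMap.opNorm_comp_le _ _))
    _ ≤ ε / (2 * K) * K + C * (ε / (2 * C)) := by
        gcongr
        · exact (hδb _ h1 z hz).2
        · exact hCb z hz
    _ = ε := by field_simp; norm_num

/-- The difference splits into a change of operator applied to the score at `ϑ₀` and the new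
operator applied to the change of score; then `(a + b)² ≤ 2a² + 2b²`. Only the first score needs a
second moment. -/
theorem sq_norm_plugin_sub_le {w : Obs d} {s : ℕ → Obs d} {n : ℕ} {t : Vec p} {z : Vec d}
    {c K m : ℝ} (hc : ‖(gradParam h t z).comp (hessian (empRisk ℓ s n) t).inverse -
      (gradParam h ϑ₀ z).comp (hessian (risk P ℓ) ϑ₀).inverse‖ ≤ c)
    (hK : ‖(gradParam h t z).comp (hessian (empRisk ℓ s n) t).inverse‖ ≤ K)
    (hm : ‖gradient (ℓ w) t - gradient (ℓ w) ϑ₀‖ ≤ m) :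
    ‖pluginInfluence ℓ h s n t w z - influence P ℓ h ϑ₀ w z‖ ^ 2 ≤
      2 * c ^ 2 * ‖gradient (ℓ w) ϑ₀‖ ^ 2 + 2 * K ^ 2 * m ^ 2 := by
  set T := (gradParam h t z).comp (hessian (empRisk ℓ s n) t).inverse with hT
  set T₀ := (gradParam h ϑ₀ z).comp (hessian (risk P ℓ) ϑ₀).inverse with hT₀
  have e : pluginInfluence ℓ h s n t w z - influence P ℓ h ϑ₀ w z =
      -((T - T₀) (gradient (ℓ w) ϑ₀) + T (gradient (ℓ w) t - gradient (ℓ w) ϑ₀)) := by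
    have e1 : pluginInfluence ℓ h s n t w z = -T (gradient (ℓ w) t) := rfl
    have e2 : influence P ℓ h ϑ₀ w z = -T₀ (gradient (ℓ w) ϑ₀) := rfl
    rw [e1, e2, sub_apply, map_sub]
    abel
  have hle : ‖pluginInfluence ℓ h s n t w z - influence P ℓ h ϑ₀ w z‖ ≤
      c * ‖gradient (ℓ w) ϑ₀‖ + K * m := by
    rw [e, norm_neg]
    exact (norm_add_le _ _).trans (add_le_add ((T - T₀).le_of_opNorm_le hc _)
      (T.le_of_opNorm_le_of_le hK hm))
  refine (pow_le_pow_left₀ (norm_nonneg _) hle 2).trans ?_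
  nlinarith [sq_nonneg (c * ‖gradient (ℓ w) ϑ₀‖ - K * m)]

theorem uniformAsymptoticLinearity_of_regular [IsProbabilityMeasure ρ] [IsFiniteMeasure P]
    (hW : IsIIDMixtureSample ρ P W 𝒵)
    (hR : RegularLoss P ℓ ϑ₀ r M) {η : Vec d → Vec 6} {Θ : Set (Vec p)}
    (hM : MEstimation ρ P W 𝒵 η Θ ℓ h ϑ₀ ϑhat) (hs : UniformSmooth h 𝒵 ϑ₀) :
    UniformAsymptoticLinearity ρ P W 𝒵 η (fun n ω z => h (ϑhat n ω) z) (influence P ℓ h ϑ₀) := by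
  have hcons := tendsto_inProb_of_tendstoInMeasure hM.consistent
  have h0 := hR.integral_score_eq_zero hM.risk_isLocalMin
  obtain ⟨hO, ho⟩ := hR.isLittleO_linearization hW.measurable hW.law hW.indep
    hM.hessian_nonsingular hcons hM.eventually_score_eq_zero
  have hφ : ∀ z, (fun w => influence P ℓ h ϑ₀ w z) = fun w =>
      (-(gradParam h ϑ₀ z).comp (hessian (risk P ℓ) ϑ₀).inverse) (gradient (ℓ w) ϑ₀) :=
    fun z => rfl
  refine ⟨fun z _ => ?_, fun z _ => ?_, ?_⟩
  · rw [hφ]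
    exact ContinuousLinearMap.comp_memLp' _ hR.score_memLp
  · rw [hφ, ContinuousLinearMap.integral_comp_comm _ (hR.score_memLp.integrable one_le_two), h0,
      map_zero]
  · rw [tendstoZeroInProb_iff]
    refine hR.tendsto_inProb_of_forall_le_score hW.measurable hW.law hW.indep hM.risk_isLocalMin
      fun ε hε => ?_
    filter_upwards [eventually_remainder_le hs hW.compact hcons hO ho hε] with q hq
    rw [enorm_smul, mul_left_comm, Real.enorm_of_nonneg (Real.sqrt_nonneg _)]
    gcongr
    refine iSup₂_le fun z hz => ?_
    rw [← hM.specified z hz, ← ofReal_norm, ← ofReal_norm, ← ENNReal.ofReal_mul hε.le]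
    exact ENNReal.ofReal_le_ofReal (hq z hz)

theorem uniformPluginConsistency_of_regular [IsProbabilityMeasure ρ] [IsFiniteMeasure P]
    (hW : IsIIDMixtureSample ρ P W 𝒵)
    (hR : RegularLoss P ℓ ϑ₀ r M) {η : Vec d → Vec 6} {Θ : Set (Vec p)}
    (hM : MEstimation ρ P W 𝒵 η Θ ℓ h ϑ₀ ϑhat) (hs : UniformSmooth h 𝒵 ϑ₀) :
    UniformPluginConsistency ρ W 𝒵
      (fun n ω => pluginInfluence ℓ h (fun i => W i ω) n (ϑhat n ω)) (influence P ℓ h ϑ₀) := by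
  have hcons := tendsto_inProb_of_tendstoInMeasure hM.consistent
  obtain ⟨hO, -⟩ := hR.isLittleO_linearization hW.measurable hW.law hW.indep
    hM.hessian_nonsingular hcons hM.eventually_score_eq_zero
  have hJ := hR.tendsto_inverse_hessian hW.measurable hW.law hW.indep hM.hessian_nonsingular hcons
  obtain ⟨C, hC, hCb⟩ := hs.exists_bound
  set J₀ := (hessian (risk P ℓ) ϑ₀).inverse
  set V := ∫ w, ‖gradient (ℓ w) ϑ₀‖ ^ 2 ∂P
  have hV : 0 ≤ V := integral_nonneg fun w => by positivity
  -- This bounds the plug-in operators, which come within `c ≤ 1` of operators of norm at most `C *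
  -- ‖J₀‖`.
  set K := C * ‖J₀‖ + 1 with hKdef
  have hK : 0 < K := by positivity
  have hLLN := tendsto_average hW.measurable hW.law hW.indep
    (f := fun w => ‖gradient (ℓ w) ϑ₀‖ ^ 2) hR.score_memLp.integrable_norm_pow'
  rw [UniformPluginConsistency, tendstoZeroInProb_iff, ENNReal.tendsto_nhds_zero]
  intro e he
  obtain ⟨ε, hε, hεe⟩ : ∃ ε : ℝ, 0 < ε ∧ ENNReal.ofReal ε ≤ e := by
    rcases eq_or_ne e ∞ with rfl | h
    · exact ⟨1, one_pos, le_top⟩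
    · exact ⟨e.toReal, ENNReal.toReal_pos he.ne' h, ENNReal.ofReal_toReal_le⟩
  -- The mean squared score at `ϑ₀` is below `V + 1` with probability tending to one, so the change
  -- of operator costs at most `ε / 2`.
  obtain ⟨c, hc, hc1, hcε⟩ : ∃ c : ℝ, 0 < c ∧ c ≤ 1 ∧ 2 * c ^ 2 * (V + 1) ≤ ε / 2 := by
    refine ⟨min 1 (ε / (4 * (V + 1))), by positivity, min_le_left _ _, ?_⟩
    set c := min 1 (ε / (4 * (V + 1)))
    have h1 : c ^ 2 ≤ c := by
      have : 0 ≤ c := by positivity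
      nlinarith [min_le_left 1 (ε / (4 * (V + 1)))]
    calc 2 * c ^ 2 * (V + 1) ≤ 2 * (ε / (4 * (V + 1))) * (V + 1) := by
          gcongr
          exact h1.trans (min_le_right _ _)
      _ = ε / 2 := by field_simp; norm_num
  filter_upwards [eventually_comp_inverse_close hs hW.compact hcons hJ hc,
    hLLN.eventually (gt_mem_nhds (lt_add_one V)),
    hR.eventually_average_sq_mul_le hW.measurable hW.law hW.indep hM.risk_isLocalMin hO
      (show 0 < ε / (4 * K ^ 2) by positivity),
    hR.eventually_contDiffOn hW.measurable hW.law,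
    hcons.eventually (Metric.ball_mem_nhds ϑ₀ hR.pos)] with q h1 h2 h3 h4 h5
  refine iSup₂_le fun z hz => (ENNReal.ofReal_le_ofReal ?_).trans hεe
  have hKz : ‖(gradParam h (ϑhat q.1 q.2) z).comp
      (hessian (empRisk ℓ (fun i => W i q.2) q.1) (ϑhat q.1 q.2)).inverse‖ ≤ K := by
    have e1 := norm_sub_norm_le ((gradParam h (ϑhat q.1 q.2) z).comp
      (hessian (empRisk ℓ (fun i => W i q.2) q.1) (ϑhat q.1 q.2)).inverse)
      ((gradParam h ϑ₀ z).comp J₀)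
    have e2 := ContinuousLinearMap.opNorm_comp_le (gradParam h ϑ₀ z) J₀
    have e3 := mul_le_mul_of_nonneg_right (hCb z hz) (norm_nonneg J₀)
    linarith [h1 z hz]
  calc _ ≤ (q.1 : ℝ)⁻¹ * ∑ i ∈ Finset.range q.1,
        (2 * c ^ 2 * ‖gradient (ℓ (W i q.2)) ϑ₀‖ ^ 2 +
          2 * K ^ 2 * (M (W i q.2) * ‖ϑhat q.1 q.2 - ϑ₀‖) ^ 2) := by
        gcongr with i hi
        exact sq_norm_plugin_sub_le (h1 z hz) hKz (norm_gradient_sub_le (h4 i) h5)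
    _ = 2 * c ^ 2 * ((q.1 : ℝ)⁻¹ • ∑ i ∈ Finset.range q.1, ‖gradient (ℓ (W i q.2)) ϑ₀‖ ^ 2) +
        2 * K ^ 2 * (((q.1 : ℝ)⁻¹ * ∑ i ∈ Finset.range q.1, M (W i q.2) ^ 2) *
          ‖ϑhat q.1 q.2 - ϑ₀‖ ^ 2) := by
        simp only [mul_pow, Finset.sum_add_distrib, ← Finset.mul_sum, ← Finset.sum_mul,
          smul_eq_mul]
        ring
    _ ≤ 2 * c ^ 2 * (V + 1) + 2 * K ^ 2 * (ε / (4 * K ^ 2)) := by gcongr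
    _ ≤ ε / 2 + ε / 2 := by
        gcongr
        apply le_of_eq
        field_simp
        norm_num
    _ = ε := add_halves ε

end PlugIn

end PNS

theorem mainTheorem4 {Ω : Type*} [MeasurableSpace Ω] (ρ : Measure Ω) [IsProbabilityMeasure ρ]
    {d p : ℕ} (P : Measure (PNS.Obs d)) (W : ℕ → Ω → PNS.Obs d) (𝒵 : Set (PNS.Vec d))
    (η : PNS.Vec d → PNS.Vec 6) (Θ : Set (PNS.Vec p)) (ℓ : PNS.Obs d → PNS.Vec p → ℝ)
    (h : PNS.Vec p → PNS.Vec d → PNS.Vec 6) (ϑ₀ : PNS.Vec p) (ϑhat : ℕ → Ω → PNS.Vec p)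
    (hW : PNS.IsIIDMixtureSample ρ P W 𝒵)
    (hη : PNS.IsAtomicProb P η)
    (hM : PNS.MEstimation ρ P W 𝒵 η Θ ℓ h ϑ₀ ϑhat)
    (hsmooth : PNS.UniformSmooth h 𝒵 ϑ₀)
    (hLip : PNS.LipschitzGrad h 𝒵 ϑ₀) :
    PNS.UniformAsymptoticLinearity ρ P W 𝒵 η
        (fun n ω z => h (ϑhat n ω) z) (PNS.influence P ℓ h ϑ₀) ∧
      PNS.UniformPluginConsistency ρ W 𝒵
        (fun n ω => PNS.pluginInfluence ℓ h (fun i => W i ω) n (ϑhat n ω))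
        (PNS.influence P ℓ h ϑ₀) := by
  have hP : IsProbabilityMeasure P := by
    rw [← hW.law 0]
    exact Measure.isProbabilityMeasure_map (hW.measurable 0).aemeasurable
  obtain ⟨r, M, hR⟩ := hM.exists_regularLoss
  exact ⟨PNS.uniformAsymptoticLinearity_of_regular hW hR hM hsmooth,
    PNS.uniformPluginConsistency_of_regular hW hR hM hsmooth⟩
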